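/- Let $G$ be a finite solvable group and let $H$ be a subgroup of $\operatorname{Aut}(G)$. Suppose that $G$ has an $H$-invariant Carter subgroup $F$ (a nilpotent subgroup with $N_G(F)=F$) such that the semidirect product $FH$, formed with respect to the action of $H$ on $F$ by restriction, is a Frobenius group with kernel $F$. Write $C_G(H)=\{g\in G : g^{\varphi}=g \text{ for all } \varphi\in H\}$. For a finite solvable group $X$ let $1=F_0(X)\le F_1(X)\le F_2(X)\le\cdots$ be its Fitting series, where $F_{n+1}(X)/F_n(X)$ is the Fitting subgroup (the largest nilpotent normal subgroup) of $X/F_n(X)$, and let the Fitting height $h(X)$ be the least $n\ge 0$ with $F_n(X)=X$. Then: (a) $F_n(C_G(H))=F_n(G)\cap C_G(H)$ for all $n\in\mathbb{N}$; (b) $h(G)\le h(C_G(H))+1$. In fact, $G=F\,F_m(G)$, where $m=h(C_G(H))$. -/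

import Mathlib

/-- The Fitting subgroup of a group: the join of all its nilpotent normal subgroups.
For a finite group this is its largest nilpotent normal subgroup. -/
def fittingSubgroup (G : Type*) [Group G] : Subgroup G :=
  sSup {N : Subgroup G | N.Normal ∧ Group.IsNilpotent N}

theorem fittingSubgroup_normal (G : Type*) [Group G] : (fittingSubgroup G).Normal :=
  Subgroup.sSup_normal _ fun _ hN => hN.1

/-- One step up in the Fitting series: the full preimage in `G` of the Fitting subgroup
of `G ⧸ N`, together with its normality. -/
def fittingStep {G : Type*} [Group G] (N : {N : Subgroup G // N.Normal}) :
    {N : Subgroup G // N.Normal} :=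
  haveI := N.2
  haveI := fittingSubgroup_normal (G ⧸ N.1)
  ⟨(fittingSubgroup (G ⧸ N.1)).comap (QuotientGroup.mk' N.1), inferInstance⟩

/-- The Fitting series: `F₀(G) = 1` and `Fₙ₊₁(G) / Fₙ(G)` is the Fitting subgroup of
`G / Fₙ(G)`. -/
def fittingSeries (G : Type*) [Group G] (n : ℕ) : Subgroup G :=
  (fittingStep^[n] ⟨⊥, inferInstance⟩).1

/-- The Fitting height: the least `n` with `Fₙ(G) = G`. (Such an `n` exists for every finite
solvable group.) -/
noncomputable def fittingHeight (G : Type*) [Group G] : ℕ :=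
  sInf {n : ℕ | fittingSeries G n = ⊤}

/-- A Carter subgroup: a nilpotent self-normalizing subgroup. -/
def IsCarterSubgroup {G : Type*} [Group G] (F : Subgroup G) : Prop :=
  Group.IsNilpotent F ∧ Subgroup.normalizer (F : Set G) = F

/-- `A` is a Frobenius group with kernel `K`: `K` is a nontrivial normal subgroup having a
nontrivial complement `C`, no nonidentity element of which centralizes a nonidentity
element of `K`. -/
def IsFrobeniusGroupWithKernel {A : Type*} [Group A] (K : Subgroup A) : Prop :=
  K.Normal ∧ K ≠ ⊥ ∧ ∃ C : Subgroup A, C ≠ ⊥ ∧ Subgroup.IsComplement' K C ∧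
    ∀ c ∈ C, c ≠ 1 → ∀ k ∈ K, c * k * c⁻¹ = k → k = 1

/-- `F` is invariant under the group of automorphisms `H`. -/
def IsInvariantUnder {G : Type*} [Group G] (H : Subgroup (MulAut G)) (F : Subgroup G) : Prop :=
  ∀ φ ∈ H, ∀ x ∈ F, φ x ∈ F

/-- The action of `H` on an `H`-invariant subgroup `F`, by restriction of automorphisms. -/
def restrictedAction {G : Type*} [Group G] (H : Subgroup (MulAut G)) (F : Subgroup G)
    (hF : IsInvariantUnder H F) : H →* MulAut F where
  toFun φ :=
    { toFun := fun x => ⟨(φ : MulAut G) x, hF φ φ.2 x x.2⟩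
      invFun := fun x => ⟨(φ : MulAut G)⁻¹ x, hF _ (H.inv_mem φ.2) x x.2⟩
      left_inv := fun x => Subtype.ext (MulAut.inv_apply_self G (φ : MulAut G) x)
      right_inv := fun x => Subtype.ext (MulAut.apply_inv_self G (φ : MulAut G) x)
      map_mul' := fun x y => Subtype.ext (map_mul (φ : MulAut G) (x : G) y) }
  map_one' := rfl
  map_mul' _ _ := rfl

/-! The Frobenius hypothesis enters only through the fact that a nontrivial h in H fixes no
nontrivial element of F, and the Carter hypothesis through nilpotency of F and self-normalization of
FN for N normal in G (`IsCarter.mem_sup_of_conj`). Both conditions pass to quotients by H-invariant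
normal subgroups (`IsFrobeniusCarter.map_mk`), so inductions run through H-invariant normal
elementary abelian p-subgroups V.

The order of H is prime to that of F, but not necessarily to that of V, so coprime action of H on V
is not available. Its substitute is the Hall p'-subgroup E of F: its order is prime to p, H acts on
it without fixed points, and C_V(E) ≤ F (`IsCarter.mem_of_commute`). Identities between the trace
over H and the norm over E then give two facts. Crossed homomorphisms H → V are principal, so fixed
points of H lift from quotients (`IsFrobeniusCarter.exists_mul_mem_fixed`). If C_V(H) = 1, then V ≤
F; hence C_G(H) = 1 forces G = F (`IsFrobeniusCarter.eq_top_of_fixedSubgroup_eq_bot`).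

The heart of (a) is that a normal q-subgroup X of C_G(H) has a q-group as normal closure in G
(`IsFrobeniusCarter.isPGroup_normalClosure`). When p ≠ q, X centralizes C_V(H) and must be shown to
centralize V. This is a statement about linear groups, proved with weight spaces of the center of a
q-group, Glauberman's lemma and the Carter property (`IsFrobeniusCarter.apply_eq_one_of_trace`).

It follows that the Fitting subgroup of C_G(H) is cut out by that of G, and lifting of fixed points
extends this to the whole series. With m the height of C_G(H), G/F_m(G) has no nontrivial fixed
points, so it is the image of F and nilpotent; this is (b). -/

open scoped Pointwise commutatorElement TensorProduct

/-! ### Fixed-point-free maps and Glauberman's lemma -/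

/-- If a finite group has no nontrivial fixed points under an endomorphism, then neither have the
coset spaces of invariant subgroups. -/
theorem mem_of_inv_mul_apply_mem {G : Type*} [Group G] (φ : G →* G) (F K : Subgroup G) [Finite F]
    (hF : ∀ x ∈ F, φ x ∈ F) (hK : ∀ x ∈ K, φ x ∈ K) (hfix : ∀ x ∈ F, φ x = x → x = 1)
    {f : G} (hf : f ∈ F) (h : f⁻¹ * φ f ∈ K) : f ∈ K := by
  -- Without fixed points, y ↦ y⁻¹φ(y) is injective on F, hence a permutation of the finite set F ⊓
  -- K. The preimage of f⁻¹φ(f) there can only be f.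
  let θ : ↥(F ⊓ K) → ↥(F ⊓ K) := fun y =>
    ⟨(y : G)⁻¹ * φ y, F.mul_mem (F.inv_mem y.2.1) (hF _ y.2.1),
      K.mul_mem (K.inv_mem y.2.2) (hK _ y.2.2)⟩
  have key : ∀ a ∈ F, ∀ b ∈ F, a⁻¹ * φ a = b⁻¹ * φ b → a = b := by
    intro a ha b hb hab
    have h1 : φ (a * b⁻¹) = a * b⁻¹ := by
      have : φ a = a * (b⁻¹ * φ b) := by rw [← hab]; group
      rw [map_mul, map_inv, this]; group
    have := hfix _ (F.mul_mem ha (F.inv_mem hb)) h1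
    exact mul_inv_eq_one.mp this
  have hinj : Function.Injective θ := fun a b hab =>
    Subtype.ext (key a a.2.1 b b.2.1 (congrArg Subtype.val hab))
  have : Finite ↥(F ⊓ K) := Finite.of_injective (Subgroup.inclusion (inf_le_left : F ⊓ K ≤ F))
    (Subgroup.inclusion_injective _)
  obtain ⟨y, hy⟩ := Finite.surjective_of_injective hinj
    ⟨f⁻¹ * φ f, F.mul_mem (F.inv_mem hf) (hF _ hf), h⟩
  have := key y y.2.1 f hf (congrArg Subtype.val hy)
  exact this ▸ y.2.2

/-- A group `T` acting coprimely on a group `V` whose commutators fix `o`, compatibly with actions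
on a set, fixes a point in the `V`-orbit of `o` as soon as it stabilizes that orbit. -/
theorem exists_smul_fixed_of_commutator_smul_eq {X O : Type*} [Group X] [MulAction X O]
    (V T : Subgroup X) [Finite V] [Finite T] (o : O)
    (hnorm : ∀ t ∈ T, ∀ v ∈ V, t * v * t⁻¹ ∈ V)
    (hcomm : ∀ a ∈ V, ∀ b ∈ V, ⁅a, b⁆ • o = o)
    (horb : ∀ t ∈ T, ∃ v ∈ V, t • o = v • o)
    (hcop : (Nat.card V).Coprime (Nat.card T)) :
    ∃ v ∈ V, ∀ t ∈ T, t • v • o = v • o := by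
  classical
  have : Fintype T := Fintype.ofFinite T
  let B : Subgroup V := MulAction.stabilizer V o
  have hBmem : ∀ v : V, v ∈ B ↔ (v : X) • o = o := fun v => MulAction.mem_stabilizer_iff
  have hcB : ∀ a b : V, ⁅a, b⁆ ∈ B := fun a b => (hBmem _).2 (hcomm a a.2 b b.2)
  have hBn : B.Normal := by
    refine ⟨fun n hn g => ?_⟩
    have : g * n * g⁻¹ = ⁅g, n⁆ * n := by rw [commutatorElement_def]; group
    rw [this]
    exact B.mul_mem (hcB _ _) hn
  let Q := V ⧸ B
  let _ : CommGroup Q :=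
    { (inferInstance : Group Q) with
      mul_comm := by
        rintro ⟨a⟩ ⟨b⟩
        change ((a * b : V) : Q) = ((b * a : V) : Q)
        rw [QuotientGroup.eq]
        have : (a * b)⁻¹ * (b * a) = ⁅b⁻¹, a⁻¹⁆ := by rw [commutatorElement_def]; group
        rw [this]; exact hcB _ _ }
  have hstab : ∀ a ∈ V, ∀ b ∈ V, a • b • o = b • o ↔ a • o = o := by
    intro a ha b hb
    have h1 : a * b = b * (a * ⁅a⁻¹, b⁻¹⁆) := by rw [commutatorElement_def]; group
    rw [smul_smul, h1, mul_smul, mul_smul, hcomm _ (V.inv_mem ha) _ (V.inv_mem hb)]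
    exact ⟨fun h => MulAction.injective b h, fun h => by rw [h]⟩
  choose! d hdV hd using horb
  let ψ : V →* Q := QuotientGroup.mk' B
  have hψ : ∀ a b : V, (a : X) • o = (b : X) • o → ψ a = ψ b := by
    intro a b hab
    refine (QuotientGroup.eq).2 ((hBmem _).2 ?_)
    rw [Subgroup.coe_mul, mul_smul, ← hab, Subgroup.coe_inv, inv_smul_smul]
  have hψ' : ∀ a b : V, ψ a = ψ b → (a : X) • o = (b : X) • o := by
    intro a b hab
    have := (hBmem _).1 ((QuotientGroup.eq).1 hab)
    rw [Subgroup.coe_mul, mul_smul, Subgroup.coe_inv, inv_smul_eq_iff] at this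
    exact this.symm
  let cj : T → (V →* V) := fun t =>
    { toFun := fun v => ⟨(t : X) * v * (t : X)⁻¹, hnorm t t.2 v v.2⟩
      map_one' := Subtype.ext (by simp)
      map_mul' := fun a b => Subtype.ext (by simp [mul_assoc]) }
  have hcj : ∀ (t : T) (v : V), v ∈ B → cj t v ∈ B := by
    intro t v hv
    rw [hBmem] at hv ⊢
    have h1 : ((cj t v : V) : X) • d t • o = d t • o := by
      rw [← hd t t.2]
      change ((t : X) * v * (t : X)⁻¹) • (t : X) • o = _
      rw [smul_smul, inv_mul_cancel_right, mul_smul, hv]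
    exact (hstab _ (cj t v).2 _ (hdV t t.2)).1 h1
  let cq : T → (Q →* Q) := fun t => QuotientGroup.map B B (cj t) (fun v hv => hcj t v hv)
  have hcq : ∀ t v, cq t (ψ v) = ψ (cj t v) := fun t v => rfl
  -- Modulo the stabilizer B, the elements d t with t • o = d t • o form a crossed homomorphism from
  -- T to the abelian group V/B. A fixed point in the orbit is a trivialization of it, found by
  -- averaging over T.
  let δ : T → V := fun t => ⟨d t, hdV t t.2⟩
  have hδ : ∀ t s : T, cq t (ψ (δ s)) * ψ (δ t) = ψ (δ (t * s)) := by
    intro t s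
    rw [hcq, ← map_mul]
    apply hψ
    change ((t : X) * d s * (t : X)⁻¹ * d t) • o = d ((t * s : T) : X) • o
    rw [mul_smul, ← hd t t.2, smul_smul, inv_mul_cancel_right, mul_smul, ← hd s s.2, ← hd _ (t * s).2,
      smul_smul]
    rfl
  let P : Q := ∏ s : T, ψ (δ s)
  have hP : ∀ t : T, cq t P * ψ (δ t) ^ Nat.card T = P := by
    intro t
    have h1 : cq t P * ψ (δ t) ^ Nat.card T = ∏ s : T, ψ (δ (t * s)) := by
      simp only [← hδ, Finset.prod_mul_distrib, P, map_prod, Finset.prod_const, Finset.card_univ,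
        Nat.card_eq_fintype_card]
    rw [h1]
    exact Fintype.prod_equiv (Equiv.mulLeft t) _ _ fun s => rfl
  -- This `Nat.gcdB` is an inverse of |T| modulo |V|; it undoes the exponent |T| in `hP`.
  obtain ⟨w, hw⟩ := QuotientGroup.mk'_surjective B
    (P ^ ((Nat.gcdB (Nat.card V) (Nat.card T))))
  refine ⟨w, w.2, fun t ht => ?_⟩
  have hx : (ψ (δ ⟨t, ht⟩) ^ Nat.card T) ^ (Nat.gcdB (Nat.card V) (Nat.card T)) =
      ψ (δ ⟨t, ht⟩) := by
    have h1 := Nat.gcd_eq_gcd_ab (Nat.card V) (Nat.card T)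
    rw [hcop.gcd_eq_one] at h1
    have h2 : ψ (δ ⟨t, ht⟩) ^ (Nat.card V : ℤ) = 1 := by
      rw [← map_zpow, zpow_natCast, pow_card_eq_one', map_one]
    rw [← zpow_natCast, ← zpow_mul]
    have h3 : (Nat.card T : ℤ) * (Nat.card V).gcdB (Nat.card T) =
      1 - Nat.card V * (Nat.card V).gcdA (Nat.card T) := by
        have : ((1 : ℕ) : ℤ) = 1 := rfl
        linarith
    rw [h3, zpow_sub, zpow_one, zpow_mul, h2, one_zpow, inv_one, mul_one]
  have hfin : cq ⟨t, ht⟩ (ψ w) * ψ (δ ⟨t, ht⟩) = ψ w := by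
    change cq ⟨t, ht⟩ (QuotientGroup.mk' B w) * _ = QuotientGroup.mk' B w
    rw [hw, map_zpow]
    conv_lhs => rw [← hx]
    rw [← mul_zpow, hP]
  rw [hcq, ← map_mul] at hfin
  have := hψ' _ _ hfin
  refine Eq.trans ?_ this
  change t • (w : X) • o = (t * w * t⁻¹ * d t) • o
  rw [mul_smul, ← hd t ht, smul_smul, smul_smul, inv_mul_cancel_right]

/-- **Glauberman's lemma** for a solvable group `M` acted on coprimely by `T`. -/
theorem exists_smul_fixed_of_coprime {X O : Type*} [Group X] [MulAction X O]
    (T : Subgroup X) [Finite T] (M : Subgroup X) [Finite M] [Group.IsSolvable M] (o : O)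
    (hnorm : ∀ t ∈ T, ∀ v ∈ M, t * v * t⁻¹ ∈ M)
    (horb : ∀ t ∈ T, ∃ v ∈ M, t • o = v • o)
    (hcop : (Nat.card M).Coprime (Nat.card T)) :
    ∃ v ∈ M, ∀ t ∈ T, t • v • o = v • o := by
  induction hn : Nat.card M using Nat.strong_induction_on generalizing M o with
  | _ n ih =>
  by_cases hM : M = ⊥
  · subst hM
    refine ⟨1, Subgroup.one_mem _, fun t ht => ?_⟩
    obtain ⟨v, hv, hv'⟩ := horb t ht
    rw [Subgroup.mem_bot.1 hv] at hv'
    rw [one_smul, hv', one_smul]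
  · let M' : Subgroup X := ⁅M, M⁆
    have hlt : M' < M := by
      have h1 : commutator M < ⊤ := by
        have : Nontrivial M := (Subgroup.nontrivial_iff_ne_bot _).2 hM
        exact Group.IsSolvable.commutator_lt_top_of_nontrivial M
      have h2 := (Subgroup.map_subtype_lt_map_subtype (G' := M)).2 h1
      rwa [Subgroup.map_subtype_commutator, ← MonoidHom.range_eq_map, Subgroup.range_subtype] at h2
    have hle : M' ≤ M := hlt.le
    have : Finite M' := Finite.of_injective _ (Subgroup.inclusion_injective hle)
    have : Group.IsSolvable M' :=
      Group.isSolvable_of_isSolvable_injective (Subgroup.inclusion_injective hle)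
    have hconj : ∀ x : X, (∀ v ∈ M, x * v * x⁻¹ ∈ M) → ∀ v ∈ M', x * v * x⁻¹ ∈ M' := by
      intro x hx v hv
      have hmap : M.map (MulAut.conj x).toMonoidHom ≤ M := by
        rintro _ ⟨v, hv, rfl⟩
        exact hx v hv
      have : M'.map (MulAut.conj x).toMonoidHom ≤ M' := by
        rw [Subgroup.map_commutator]
        exact Subgroup.commutator_mono hmap hmap
      exact this ⟨v, hv, rfl⟩
    have hMM : ∀ x ∈ M, ∀ v ∈ M', x * v * x⁻¹ ∈ M' := fun x hx =>
      hconj x fun v hv => M.mul_mem (M.mul_mem hx hv) (M.inv_mem hx)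
    have hTM : ∀ x ∈ T, ∀ v ∈ M', x * v * x⁻¹ ∈ M' := fun x hx => hconj x (hnorm x hx)
    have hsmul : ∀ x : X, (∀ v ∈ M', x * v * x⁻¹ ∈ M') → (∀ v ∈ M', x⁻¹ * v * x ∈ M') → ∀ o : O,
        x • ((fun v : X => v • o) '' (M' : Set X)) = (fun v : X => v • x • o) '' (M' : Set X) := by
      intro x hx hx' o
      ext y
      constructor
      · rintro ⟨_, ⟨v, hv, rfl⟩, rfl⟩
        exact ⟨x * v * x⁻¹, hx v hv, by simp [smul_smul]⟩
      · rintro ⟨v, hv, rfl⟩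
        exact ⟨_, ⟨x⁻¹ * v * x, hx' v hv, rfl⟩, by simp [smul_smul, mul_assoc]⟩
    have hsM : ∀ x ∈ M, ∀ o : O,
        x • ((fun v : X => v • o) '' (M' : Set X)) = (fun v : X => v • x • o) '' (M' : Set X) :=
      fun x hx => hsmul x (hMM x hx) (by simpa using hMM _ (M.inv_mem hx))
    have hsT : ∀ x ∈ T, ∀ o : O,
        x • ((fun v : X => v • o) '' (M' : Set X)) = (fun v : X => v • x • o) '' (M' : Set X) :=
      fun x hx => hsmul x (hTM x hx) (by simpa using hTM _ (T.inv_mem hx))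
    -- Commutators of M fix the M'-orbit of o, so the abelian case, applied to M'-orbits as points,
    -- makes the M'-orbit of some v • o stable under T. The induction hypothesis for M' then finds a
    -- fixed point inside that orbit.
    obtain ⟨v, hv, hfix⟩ := exists_smul_fixed_of_commutator_smul_eq M T
      ((fun v : X => v • o) '' (M' : Set X)) hnorm
      (by
        intro a ha b hb
        have hab : ⁅a, b⁆ ∈ M' := Subgroup.commutator_mem_commutator ha hb
        rw [hsM _ (hle hab)]
        ext y
        constructor
        · rintro ⟨v, hv, rfl⟩
          exact ⟨v * ⁅a, b⁆, M'.mul_mem hv hab, by simp [smul_smul]⟩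
        · rintro ⟨v, hv, rfl⟩
          exact ⟨v * ⁅a, b⁆⁻¹, M'.mul_mem hv (M'.inv_mem hab), by
            simp only [smul_smul, inv_mul_cancel_right]⟩)
      (by
        intro t ht
        obtain ⟨v, hv, hvo⟩ := horb t ht
        exact ⟨v, hv, by rw [hsT t ht, hsM v hv, hvo]⟩) hcop
    obtain ⟨w, hw, hw'⟩ := ih (Nat.card M') (by
        rw [← hn]
        exact Set.ncard_lt_ncard (SetLike.coe_ssubset_coe.2 hlt) (Set.toFinite (M : Set X))) M'
      (v • o) hTM
      (by
        intro t ht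
        have h1 := hfix t ht
        rw [hsM v hv, hsT t ht] at h1
        have h2 : t • v • o ∈ (fun u : X => u • v • o) '' (M' : Set X) := by
          rw [← h1]; exact ⟨1, M'.one_mem, one_smul _ _⟩
        obtain ⟨u, hu, hu'⟩ := h2
        exact ⟨u, hu, hu'.symm⟩)
      (hcop.coprime_dvd_left (Subgroup.card_dvd_of_le hle)) rfl
    exact ⟨w * v, M.mul_mem (hle hw) hv, fun t ht => by rw [mul_smul]; exact hw' t ht⟩

/-! ### Primary parts of elements and nilpotent groups -/

/-- Bézout for the p-part and the p'-part of the order of x splits x into a p'-element y and a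
p-element z. Both are powers of x, so they lie in every subgroup containing x. -/
theorem exists_mul_eq_of_prime {G : Type*} [Group G] (p : ℕ) [Fact p.Prime] {x : G}
    (hx : IsOfFinOrder x) : ∃ y ∈ Subgroup.zpowers x, ∃ z ∈ Subgroup.zpowers x,
      x = y * z ∧ (orderOf y).Coprime p ∧ ∃ k, z ^ p ^ k = 1 := by
  obtain ⟨k, m, hm, hkm⟩ := Nat.exists_eq_pow_mul_and_not_dvd (hx.orderOf_pos.ne') p
    (Fact.out (p := p.Prime)).ne_one
  have hc : (p ^ k).Coprime m := Nat.Coprime.pow_left _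
    (((Fact.out (p := p.Prime)).coprime_iff_not_dvd).2 hm)
  have hb := Nat.gcd_eq_gcd_ab (p ^ k) m
  rw [hc.gcd_eq_one] at hb
  refine ⟨x ^ (((p ^ k : ℕ) : ℤ) * Nat.gcdA (p ^ k) m), Subgroup.zpow_mem_zpowers _ _,
    x ^ ((m : ℤ) * Nat.gcdB (p ^ k) m), Subgroup.zpow_mem_zpowers _ _, ?_, ?_, k, ?_⟩
  · rw [← zpow_add, ← hb, Nat.cast_one, zpow_one]
  · have : orderOf (x ^ (((p ^ k : ℕ) : ℤ) * Nat.gcdA (p ^ k) m)) ∣ m := by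
      refine orderOf_dvd_of_pow_eq_one ?_
      rw [← zpow_natCast, ← zpow_mul, mul_right_comm, ← Nat.cast_mul, ← hkm, zpow_mul, zpow_natCast,
        pow_orderOf_eq_one, one_zpow]
    exact Nat.Coprime.coprime_dvd_left this
      ((Nat.coprime_comm.1 (((Fact.out (p := p.Prime)).coprime_iff_not_dvd).2 hm)))
  · rw [← zpow_natCast, ← zpow_mul, mul_right_comm, ← Nat.cast_mul, mul_comm m, ← hkm, zpow_mul,
      zpow_natCast, pow_orderOf_eq_one, one_zpow]

theorem eq_one_of_pow_prime_pow_eq_one {G : Type*} [Group G] {p : ℕ} {x : G} {k : ℕ}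
    (hx : x ^ p ^ k = 1) (hc : (orderOf x).Coprime p) : x = 1 := by
  rw [← orderOf_eq_one_iff]
  exact Nat.Coprime.eq_one_of_dvd (hc.pow_right k) (orderOf_dvd_of_pow_eq_one hx)

namespace Group.IsNilpotent

variable {N : Type*} [Group N] [Finite N] [Group.IsNilpotent N]

theorem nonempty_directProduct :
    Nonempty ((∀ p : (Nat.card N).primeFactors, ∀ P : Sylow p N, (↑P : Subgroup N)) ≃* N) :=
  (Group.isNilpotent_of_finite_tfae (G := N)).out 0 4 rfl rfl |>.1 ‹_›

/-- In the product of the Sylow subgroups, at each prime one of the two coordinates is trivial. -/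
theorem commute_of_coprime_orderOf {x y : N} (h : (orderOf x).Coprime (orderOf y)) :
    Commute x y := by
  obtain ⟨e⟩ := nonempty_directProduct (N := N)
  obtain ⟨a, rfl⟩ := e.surjective x
  obtain ⟨b, rfl⟩ := e.surjective y
  rw [e.orderOf_eq, e.orderOf_eq] at h
  suffices Commute a b from this.map e
  refine funext fun p => funext fun P => ?_
  let π := ((Pi.evalMonoidHom _ P).comp (Pi.evalMonoidHom
    (fun q : (Nat.card N).primeFactors => ∀ P : Sylow q N, (↑P : Subgroup N)) p))
  have ha : orderOf (a p P) ∣ orderOf a := orderOf_map_dvd π a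
  have hb : orderOf (b p P) ∣ orderOf b := orderOf_map_dvd π b
  have hab := Nat.Coprime.coprime_dvd_left ha (Nat.Coprime.coprime_dvd_right hb h)
  have : Fact (Nat.Prime p) := ⟨Nat.prime_of_mem_primeFactors p.2⟩
  obtain ⟨i, hi⟩ := IsPGroup.iff_orderOf.1 P.2 (a p P)
  obtain ⟨j, hj⟩ := IsPGroup.iff_orderOf.1 P.2 (b p P)
  rw [hi, hj] at hab
  have hp := Nat.prime_of_mem_primeFactors p.2
  rcases Nat.eq_zero_or_pos i with rfl | hi0
  · rw [pow_zero, orderOf_eq_one_iff] at hi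
    simp [hi]
  · rcases Nat.eq_zero_or_pos j with rfl | hj0
    · rw [pow_zero, orderOf_eq_one_iff] at hj
      simp [hj]
    · exfalso
      have := Nat.Coprime.coprime_dvd_left (dvd_pow_self (p : ℕ) hi0.ne')
        (Nat.Coprime.coprime_dvd_right (dvd_pow_self (p : ℕ) hj0.ne') hab)
      exact hp.ne_one ((Nat.coprime_self _).1 this)

/-- The p-part of xy is trivial in every Sylow coordinate: at p because it is a power of xy and x, y
have trivial p-coordinates, elsewhere because its order is a power of p. -/
theorem coprime_orderOf_mul {p : ℕ} [Fact p.Prime] {x y : N} (hx : (orderOf x).Coprime p)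
    (hy : (orderOf y).Coprime p) : (orderOf (x * y)).Coprime p := by
  obtain ⟨a, ha, b, hb, hab, hap, k, hbk⟩ := exists_mul_eq_of_prime p (isOfFinOrder_of_finite (x * y))
  suffices b = 1 by rwa [hab, this, mul_one]
  have hbp : (orderOf b) ∣ p ^ k := orderOf_dvd_of_pow_eq_one hbk
  have hc : ∀ z : N, (orderOf z).Coprime p → Commute z b := fun z hz =>
    commute_of_coprime_orderOf (Nat.Coprime.coprime_dvd_right hbp (hz.pow_right k))
  obtain ⟨e⟩ := nonempty_directProduct (N := N)
  obtain ⟨u, rfl⟩ := e.surjective x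
  obtain ⟨v, rfl⟩ := e.surjective y
  obtain ⟨w, rfl⟩ := e.surjective b
  obtain ⟨n, hn⟩ := Subgroup.mem_zpowers_iff.1 hb
  rw [← map_mul, ← map_zpow, e.injective.eq_iff] at hn
  rw [e.orderOf_eq] at hx hy hbp
  suffices w = 1 by rw [this, map_one]
  refine funext fun q => funext fun P => ?_
  have hq : Fact (Nat.Prime q) := ⟨Nat.prime_of_mem_primeFactors q.2⟩
  let π := ((Pi.evalMonoidHom _ P).comp (Pi.evalMonoidHom
    (fun q : (Nat.card N).primeFactors => ∀ P : Sylow q N, (↑P : Subgroup N)) q))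
  change π w = 1
  by_cases hqp : (q : ℕ) = p
  · have h1 : ∀ z, (orderOf z).Coprime p → π z = 1 := by
      intro z hz
      obtain ⟨i, hi⟩ := IsPGroup.iff_orderOf.1 P.2 (π z)
      refine eq_one_of_pow_prime_pow_eq_one (p := p) (k := i) ?_
        (Nat.Coprime.coprime_dvd_left (orderOf_map_dvd π z) hz)
      rw [← hqp, ← hi, pow_orderOf_eq_one]
    rw [← hn, map_zpow, map_mul, h1 u hx, h1 v hy, one_mul, one_zpow]
  · obtain ⟨i, hi⟩ := IsPGroup.iff_orderOf.1 P.2 (π w)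
    refine eq_one_of_pow_prime_pow_eq_one (p := p) (k := k)
      (orderOf_dvd_iff_pow_eq_one.1 ((orderOf_map_dvd π w).trans hbp)) ?_
    rw [hi]
    exact Nat.Coprime.pow_left _ ((Nat.coprime_primes hq.out Fact.out).2 hqp)

end Group.IsNilpotent

/-- The Hall `p'`-subgroup of a nilpotent subgroup. -/
theorem exists_subgroup_mem_iff_coprime_orderOf {G : Type*} [Group G] (F : Subgroup G) [Finite F]
    [Group.IsNilpotent F] (p : ℕ) [Fact p.Prime] :
    ∃ E : Subgroup G, ∀ x, x ∈ E ↔ x ∈ F ∧ (orderOf x).Coprime p := by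
  refine ⟨{ carrier := {x | x ∈ F ∧ (orderOf x).Coprime p}, mul_mem' := ?_, one_mem' := ?_,
            inv_mem' := ?_ }, fun x => Iff.rfl⟩
  · rintro x y ⟨hx, hx'⟩ ⟨hy, hy'⟩
    refine ⟨F.mul_mem hx hy, ?_⟩
    have := Group.IsNilpotent.coprime_orderOf_mul (N := F) (p := p) (x := ⟨x, hx⟩) (y := ⟨y, hy⟩)
      (by rwa [Subgroup.orderOf_mk]) (by rwa [Subgroup.orderOf_mk])
    rwa [← Subgroup.orderOf_coe] at this
  · exact ⟨F.one_mem, by simp⟩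
  · rintro x ⟨hx, hx'⟩
    exact ⟨F.inv_mem hx, by rwa [orderOf_inv]⟩

theorem coprime_card_of_coprime_orderOf {G : Type*} [Group G] [Finite G] {p : ℕ} [Fact p.Prime]
    (h : ∀ x : G, (orderOf x).Coprime p) : (Nat.card G).Coprime p := by
  rw [Nat.coprime_comm, (Fact.out (p := p.Prime)).coprime_iff_not_dvd]
  intro hd
  obtain ⟨x, hx⟩ := exists_prime_orderOf_dvd_card' p hd
  have := h x
  rw [hx, Nat.coprime_self] at this
  exact (Fact.out (p := p.Prime)).ne_one this

theorem Sylow.mem_of_normal_of_pow_eq_one {G : Type*} [Group G] [Finite G] {p : ℕ} [Fact p.Prime]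
    (P : Sylow p G) (hP : (P : Subgroup G).Normal) {x : G} {k : ℕ} (hx : x ^ p ^ k = 1) : x ∈ P := by
  have hz : IsPGroup p (Subgroup.zpowers x) := by
    refine IsPGroup.of_card_dvd_pow (n := k) ?_
    rw [Nat.card_zpowers]
    exact orderOf_dvd_of_pow_eq_one hx
  obtain ⟨Q, hQ⟩ := hz.exists_le_sylow
  have := Sylow.unique_of_normal P hP
  rw [Subsingleton.elim P Q]
  exact hQ (Subgroup.mem_zpowers x)

/-! ### Groups of operators -/

/-- The restriction of an action by automorphisms to an invariant subgroup. -/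
def restrictAut {G H : Type*} [Group G] [Group H] (α : H →* MulAut G) (K : Subgroup G)
    (hK : ∀ h, ∀ x ∈ K, α h x ∈ K) : H →* MulAut K where
  toFun h :=
    { toFun := fun x => ⟨α h x, hK h x x.2⟩
      invFun := fun x => ⟨α h⁻¹ x, hK _ x x.2⟩
      left_inv := fun x => Subtype.ext (by simp)
      right_inv := fun x => Subtype.ext (by simp)
      map_mul' := fun x y => Subtype.ext (by simp) }
  map_one' := by ext; simp
  map_mul' a b := by ext; simp

@[simp]
theorem coe_restrictAut {G H : Type*} [Group G] [Group H] (α : H →* MulAut G) (K : Subgroup G)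
    (hK : ∀ h, ∀ x ∈ K, α h x ∈ K) (h : H) (x : K) : (restrictAut α K hK h x : G) = α h x := rfl

/-- The action by automorphisms induced on the quotient by an invariant normal subgroup. -/
noncomputable def quotientAut {G H : Type*} [Group G] [Group H] (α : H →* MulAut G) (N : Subgroup G) [N.Normal]
    (hN : ∀ h, ∀ x ∈ N, α h x ∈ N) : H →* MulAut (G ⧸ N) where
  toFun h := MulEquiv.ofBijective (QuotientGroup.map N N (α h).toMonoidHom (fun x hx => hN h x hx)) (by
    constructor
    · rw [injective_iff_map_eq_one]
      rintro ⟨x⟩ hx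
      refine (QuotientGroup.eq_one_iff x).2 ?_
      have : α h x ∈ N := (QuotientGroup.eq_one_iff (α h x)).1 hx
      simpa using hN h⁻¹ _ this
    · rintro ⟨x⟩
      refine ⟨((α h⁻¹ x : G) : G ⧸ N), ?_⟩
      change ((α h (α h⁻¹ x) : G) : G ⧸ N) = (x : G ⧸ N)
      simp)
  map_one' := by
    ext ⟨x⟩
    change ((α 1 x : G) : G ⧸ N) = (x : G ⧸ N)
    simp
  map_mul' a b := by
    ext ⟨x⟩
    change ((α (a * b) x : G) : G ⧸ N) = ((α a (α b x) : G) : G ⧸ N)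
    simp

/-- The fixed points of an action by automorphisms. -/
def fixedSubgroup {G H : Type*} [Group G] [Group H] (α : H →* MulAut G) : Subgroup G where
  carrier := {x | ∀ h, α h x = x}
  mul_mem' hx hy h := by rw [map_mul, hx h, hy h]
  one_mem' h := map_one _
  inv_mem' hx h := by rw [map_inv, hx h]

/-! ### Carter subgroups and their images in quotients -/

/-- A nilpotent subgroup containing every element that conjugates it into itself. In a finite
group these are the Carter subgroups. -/
structure IsCarter {G : Type*} [Group G] (F : Subgroup G) : Prop where
  nilpotent : Group.IsNilpotent F
  mem_of_conj : ∀ g : G, (∀ f ∈ F, g * f * g⁻¹ ∈ F) → g ∈ F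

/-- A Carter subgroup invariant under a group of operators each nontrivial element of which acts on
it without nontrivial fixed points. -/
structure IsFrobeniusCarter {G H : Type*} [Group G] [Group H] (α : H →* MulAut G)
    (F : Subgroup G) : Prop extends IsCarter F where
  invariant : ∀ h, ∀ f ∈ F, α h f ∈ F
  eq_one_of_fixed : ∀ h, h ≠ 1 → ∀ f ∈ F, α h f = f → f = 1

/-- Let P be the Sylow p-subgroup of F and Y = C_V(E). Then PY is a p-group in which P is
self-normalizing, because F is Carter; nilpotency of PY forces PY = P, so Y ≤ F. -/
theorem IsCarter.mem_of_commute {G : Type*} [Group G] [Finite G] {F : Subgroup G}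
    (hF : IsCarter F) {p : ℕ} [Fact p.Prime] {E V : Subgroup G}
    (hE : ∀ x, x ∈ E ↔ x ∈ F ∧ (orderOf x).Coprime p) (hV : IsPGroup p V)
    (hFV : ∀ f ∈ F, ∀ v ∈ V, f * v * f⁻¹ ∈ V) {v : G} (hv : v ∈ V)
    (hvE : ∀ e ∈ E, e * v = v * e) : v ∈ F := by
  have := hF.nilpotent
  let P₀ : Sylow p F := default
  have hP₀ : (P₀ : Subgroup F).Normal := inferInstance
  let P : Subgroup G := (P₀ : Subgroup F).map F.subtype
  have hPF : P ≤ F := Subgroup.map_subtype_le _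
  have hP : IsPGroup p P := P₀.isPGroup'.map _
  have hPmem : ∀ x ∈ F, ∀ k, x ^ p ^ k = 1 → x ∈ P := by
    intro x hx k hk
    exact ⟨⟨x, hx⟩, P₀.mem_of_normal_of_pow_eq_one hP₀ (k := k) (Subtype.ext hk), rfl⟩
  have hpow : ∀ {K : Subgroup G}, IsPGroup p K → ∀ x ∈ K, ∃ k, x ^ p ^ k = 1 := by
    intro K hK x hx
    obtain ⟨k, hk⟩ := isPGroup_iff_pow_pow_eq_one.1 hK ⟨x, hx⟩
    exact ⟨k, by simpa using congrArg Subtype.val hk⟩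
  have hPE : ∀ x ∈ P, ∀ e ∈ E, e * x = x * e := by
    intro x hx e he
    obtain ⟨k, hk⟩ := hpow hP x hx
    have : Commute (⟨e, ((hE e).1 he).1⟩ : F) ⟨x, hPF hx⟩ := by
      refine Group.IsNilpotent.commute_of_coprime_orderOf ?_
      rw [Subgroup.orderOf_mk, Subgroup.orderOf_mk]
      exact Nat.Coprime.coprime_dvd_right (orderOf_dvd_of_pow_eq_one hk)
        (((hE e).1 he).2.pow_right k)
    exact congrArg Subtype.val this
  let Y : Subgroup G := V ⊓ Subgroup.centralizer (E : Set G)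
  have hEF : ∀ f ∈ F, ∀ e ∈ E, f⁻¹ * e * f ∈ E := by
    intro f hf e he
    refine (hE _).2 ⟨F.mul_mem (F.mul_mem (F.inv_mem hf) ((hE e).1 he).1) hf, ?_⟩
    have : f⁻¹ * e * f = MulAut.conj f⁻¹ e := by simp
    rw [this, MulEquiv.orderOf_eq]
    exact ((hE e).1 he).2
  have hY : ∀ f ∈ F, ∀ y ∈ Y, f * y * f⁻¹ ∈ Y := by
    rintro f hf y ⟨hy, hy'⟩
    refine ⟨hFV f hf y hy, Subgroup.mem_centralizer_iff.2 fun e he => ?_⟩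
    have := Subgroup.mem_centralizer_iff.1 hy' _ (hEF f hf e he)
    calc e * (f * y * f⁻¹) = f * ((f⁻¹ * e * f) * y) * f⁻¹ := by group
      _ = f * y * f⁻¹ * e := by rw [this]; group
  have hPY : P ≤ Subgroup.normalizer (Y : Set G) := by
    intro x hx
    rw [Subgroup.mem_normalizer_iff]
    intro y
    refine ⟨hY x (hPF hx) y, fun h => ?_⟩
    have := hY _ (F.inv_mem (hPF hx)) _ h
    rwa [show x⁻¹ * (x * y * x⁻¹) * x⁻¹⁻¹ = y by group] at this
  have hS : IsPGroup p ↥(P ⊔ Y) := hP.to_sup_of_normal_right' (hV.to_le inf_le_left) hPY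
  have hSE : P ⊔ Y ≤ Subgroup.centralizer (E : Set G) :=
    sup_le (fun x hx => Subgroup.mem_centralizer_iff.2 fun e he => hPE x hx e he) inf_le_right
  have hnil := hS.isNilpotent
  have hnc := normalizerCondition_iff_only_full_group_self_normalizing.1
    (Group.normalizerCondition_of_isNilpotent (G := ↥(P ⊔ Y))) (P.subgroupOf (P ⊔ Y)) (by
      refine le_antisymm (fun s hs => ?_) Subgroup.le_normalizer
      -- Each f in F is a product of an element of E and one of P. Since s centralizes E and
      -- normalizes P, it conjugates F into itself.
      have hs1 : (s : G) ∈ F := by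
        refine hF.mem_of_conj _ fun f hf => ?_
        obtain ⟨y, hy, z, hz, hyz, hyp, k, hzk⟩ :=
          exists_mul_eq_of_prime p (isOfFinOrder_of_finite f)
        have hle : Subgroup.zpowers f ≤ F := (Subgroup.zpowers_le).2 hf
        have hyE : y ∈ E := (hE y).2 ⟨hle hy, hyp⟩
        have hzP : z ∈ P := hPmem z (hle hz) k hzk
        have h1 := (Subgroup.mem_normalizer_iff.1 hs
          ⟨z, (le_sup_left : P ≤ P ⊔ Y) hzP⟩).1 (Subgroup.mem_subgroupOf.2 hzP)
        have h2 : (s : G) * z * (s : G)⁻¹ ∈ P := Subgroup.mem_subgroupOf.1 h1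
        have h3 := Subgroup.mem_centralizer_iff.1 (hSE s.2) y hyE
        rw [hyz, show (s : G) * (y * z) * (s : G)⁻¹ = y * (s * z * (s : G)⁻¹) by
          rw [← mul_assoc, ← h3]; group]
        exact F.mul_mem (hle hy) (hPF h2)
      obtain ⟨k, hk⟩ := hpow hS s s.2
      exact Subgroup.mem_subgroupOf.2 (hPmem s hs1 k hk))
  have hvY : v ∈ P ⊔ Y := (le_sup_right : Y ≤ P ⊔ Y)
    ⟨hv, Subgroup.mem_centralizer_iff.2 fun e he => hvE e he⟩
  have : (⟨v, hvY⟩ : ↥(P ⊔ Y)) ∈ P.subgroupOf (P ⊔ Y) := by rw [hnc]; trivial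
  exact hPF (Subgroup.mem_subgroupOf.1 this)

/-- A Frattini argument on E: gEg⁻¹ lies in VE, so after correction by an element v of V one may
assume that g normalizes E. If then gfg⁻¹ = wf' with w in V and f' in F, the element w normalizes E,
so [w, E] ≤ V ∩ E = 1 and w ∈ F by `IsCarter.mem_of_commute`. Thus the corrected g normalizes F. -/
theorem IsCarter.mem_sup_of_conj_of_comm {G : Type*} [Group G] [Finite G] {F : Subgroup G}
    (hF : IsCarter F) {p : ℕ} [Fact p.Prime] {V : Subgroup G} [hVn : V.Normal]
    (hV : IsPGroup p V) (hcomm : ∀ a ∈ V, ∀ b ∈ V, a * b = b * a) {g : G}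
    (hg : ∀ x ∈ F ⊔ V, g * x * g⁻¹ ∈ F ⊔ V) : g ∈ F ⊔ V := by
  have := hF.nilpotent
  obtain ⟨E, hE⟩ := exists_subgroup_mem_iff_coprime_orderOf F p
  have hEF : E ≤ F := fun x hx => ((hE x).1 hx).1
  have hVpow : ∀ x ∈ V, ∃ k, x ^ p ^ k = 1 := by
    intro x hx
    obtain ⟨k, hk⟩ := isPGroup_iff_pow_pow_eq_one.1 hV ⟨x, hx⟩
    exact ⟨k, by simpa using congrArg Subtype.val hk⟩
  have hEconj : ∀ f ∈ F, ∀ e ∈ E, f * e * f⁻¹ ∈ E := by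
    intro f hf e he
    refine (hE _).2 ⟨F.mul_mem (F.mul_mem hf ((hE e).1 he).1) (F.inv_mem hf), ?_⟩
    have : f * e * f⁻¹ = MulAut.conj f e := by simp
    rw [this, MulEquiv.orderOf_eq]
    exact ((hE e).1 he).2
  -- The p-part z of the F-component of x lies in V: its image in G/V has p-power order, and also
  -- order dividing that of x, which is prime to p.
  have hsplit : ∀ x ∈ F ⊔ V, (orderOf x).Coprime p → ∃ v ∈ V, ∃ e ∈ E, x = v * e := by
    intro x hx hxp
    obtain ⟨v, hv, f, hf, hfv⟩ := Subgroup.mem_sup_of_normal_left.1 (sup_comm F V ▸ hx)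
    obtain ⟨y, hy, z, hz, hyz, hyp, k, hzk⟩ := exists_mul_eq_of_prime p (isOfFinOrder_of_finite f)
    have hle : Subgroup.zpowers f ≤ F := (Subgroup.zpowers_le).2 hf
    have hfm : f ^ orderOf x ∈ V := by
      rw [← QuotientGroup.eq_one_iff, QuotientGroup.mk_pow]
      have h1 : (f : G ⧸ V) = (x : G ⧸ V) := by
        rw [← hfv, QuotientGroup.mk_mul, (QuotientGroup.eq_one_iff v).2 hv, one_mul]
      rw [h1, ← QuotientGroup.mk_pow, pow_orderOf_eq_one, QuotientGroup.mk_one]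
    have hzV : z ∈ V := by
      obtain ⟨j, rfl⟩ := Subgroup.mem_zpowers_iff.1 hz
      rw [← QuotientGroup.eq_one_iff]
      refine eq_one_of_pow_prime_pow_eq_one (p := p) (k := k) ?_ ?_
      · rw [← QuotientGroup.mk_pow, hzk, QuotientGroup.mk_one]
      · refine Nat.Coprime.coprime_dvd_left (orderOf_dvd_of_pow_eq_one (n := orderOf x) ?_) hxp
        rw [← QuotientGroup.mk_pow, QuotientGroup.eq_one_iff, ← zpow_natCast, zpow_comm,
          zpow_natCast]
        exact V.zpow_mem hfm j
    refine ⟨v * (y * z * y⁻¹), V.mul_mem hv (hVn.conj_mem z hzV y), y, (hE y).2 ⟨hle hy, hyp⟩, ?_⟩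
    rw [← hfv, hyz]; group
  let T : Subgroup G := E.map (MulAut.conj g).toMonoidHom
  have hmemT : ∀ t ∈ T, ∃ v ∈ V, ∃ e ∈ E, t = v * e := by
    rintro _ ⟨e, he, rfl⟩
    refine hsplit _ (hg e ((le_sup_left : F ≤ F ⊔ V) (hEF he))) ?_
    rw [MulEquiv.coe_toMonoidHom, MulEquiv.orderOf_eq]
    exact ((hE e).1 he).2
  have hcardE : (Nat.card E).Coprime p := coprime_card_of_coprime_orderOf fun x => by
    rw [← Subgroup.orderOf_coe]; exact ((hE x).1 x.2).2
  have hcardT : Nat.card T = Nat.card E :=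
    Nat.card_congr (E.equivMapOfInjective _ (MulAut.conj g).injective).toEquiv.symm
  -- A coset vE fixed by T = gEg⁻¹ means that v⁻¹g conjugates E into itself; this is the conjugacy
  -- part of Schur–Zassenhaus inside VE.
  obtain ⟨v, hv, hfix⟩ := exists_smul_fixed_of_commutator_smul_eq V T ((1 : G) : G ⧸ E)
    (fun t _ v hv => hVn.conj_mem v hv t)
    (fun a ha b hb => by
      rw [show ⁅a, b⁆ = 1 by rw [commutatorElement_def, hcomm a ha b hb]; group, one_smul])
    (fun t ht => by
      obtain ⟨v, hv, e, he, rfl⟩ := hmemT t ht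
      refine ⟨v, hv, ?_⟩
      change ((v * e * 1 : G) : G ⧸ E) = ((v * 1 : G) : G ⧸ E)
      rw [QuotientGroup.eq]
      simpa using he)
    (by
      rw [hcardT]
      obtain ⟨n, hn⟩ := IsPGroup.iff_card.1 hV
      rw [hn]
      exact (hcardE.pow_right n).symm)
  have hgE : ∀ e ∈ E, (v⁻¹ * g) * e * (v⁻¹ * g)⁻¹ ∈ E := by
    intro e he
    have h1 := hfix (g * e * g⁻¹) ⟨e, he, by simp⟩
    have h2 : ((v * 1 : G) : G ⧸ E) = ((g * e * g⁻¹ * (v * 1) : G) : G ⧸ E) := h1.symm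
    rw [QuotientGroup.eq] at h2
    rw [show v⁻¹ * g * e * (v⁻¹ * g)⁻¹ = (v * 1)⁻¹ * (g * e * g⁻¹ * (v * 1)) by group]
    exact h2
  have hgE' : ∀ e ∈ E, (v⁻¹ * g)⁻¹ * e * (v⁻¹ * g) ∈ E := by
    have hmap : E.map (MulAut.conj (v⁻¹ * g)).toMonoidHom = E :=
      Subgroup.eq_of_le_of_card_ge (by rintro _ ⟨e, he, rfl⟩; exact hgE e he)
        (Nat.card_congr (E.equivMapOfInjective _ (MulAut.conj (v⁻¹ * g)).injective).toEquiv).le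
    intro e he
    rw [← hmap] at he
    obtain ⟨e', he', rfl⟩ := he
    rw [show (v⁻¹ * g)⁻¹ * (MulAut.conj (v⁻¹ * g)).toMonoidHom e' * (v⁻¹ * g) = e' by
      rw [MulEquiv.coe_toMonoidHom, MulAut.conj_apply]; group]
    exact he'
  have hvS : v ∈ F ⊔ V := (le_sup_right : V ≤ F ⊔ V) hv
  have key : v⁻¹ * g ∈ F := by
    refine hF.mem_of_conj _ fun f hf => ?_
    have h1 : v⁻¹ * g * f * (v⁻¹ * g)⁻¹ ∈ F ⊔ V := by
      have := hg f ((le_sup_left : F ≤ F ⊔ V) hf)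
      rw [show v⁻¹ * g * f * (v⁻¹ * g)⁻¹ = v⁻¹ * (g * f * g⁻¹) * v by group]
      exact mul_mem (mul_mem (inv_mem hvS) this) hvS
    obtain ⟨w, hw, f', hf', hwf⟩ := Subgroup.mem_sup_of_normal_left.1 (sup_comm F V ▸ h1)
    rw [← hwf]
    refine F.mul_mem (hF.mem_of_commute hE hV (fun f _ v hv => hVn.conj_mem v hv f) hw ?_) hf'
    intro e he
    have hweq : w = (v⁻¹ * g) * f * (v⁻¹ * g)⁻¹ * f'⁻¹ := by rw [← hwf]; group
    have hwE : w * e * w⁻¹ ∈ E := by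
      have h2 := hgE _ (hEconj f hf _ (hgE' _ (hEconj _ (F.inv_mem hf') e he)))
      rw [hweq]
      convert h2 using 1
      group
    have h3 : w * e * w⁻¹ * e⁻¹ = 1 := by
      have hmV : w * e * w⁻¹ * e⁻¹ ∈ V := by
        rw [show w * e * w⁻¹ * e⁻¹ = w * (e * w⁻¹ * e⁻¹) by group]
        exact V.mul_mem hw (hVn.conj_mem _ (V.inv_mem hw) e)
      obtain ⟨k, hk⟩ := hVpow _ hmV
      exact eq_one_of_pow_prime_pow_eq_one hk ((hE _).1 (E.mul_mem hwE (E.inv_mem he))).2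
    have h4 : w * e * w⁻¹ = e := mul_inv_eq_one.1 h3
    exact (mul_inv_eq_iff_eq_mul.1 h4).symm
  have : g = v * (v⁻¹ * g) := by group
  rw [this]
  exact mul_mem hvS ((le_sup_left : F ≤ F ⊔ V) key)

/-- A nontrivial finite solvable subgroup contains a nontrivial elementary abelian subgroup that is
preserved by every automorphism preserving the given subgroup. -/
theorem exists_elementaryAbelian_le {G : Type*} [Group G] (N : Subgroup G) [Finite N]
    [Group.IsSolvable N] (hN : N ≠ ⊥) :
    ∃ p : ℕ, p.Prime ∧ ∃ V : Subgroup G, V ≤ N ∧ V ≠ ⊥ ∧ (∀ a ∈ V, ∀ b ∈ V, a * b = b * a) ∧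
      (∀ v ∈ V, v ^ p = 1) ∧
      ∀ φ : MulAut G, (∀ x ∈ N, φ x ∈ N) → ∀ x ∈ V, φ x ∈ V := by
  induction hn : Nat.card N using Nat.strong_induction_on generalizing N with
  | _ n ih =>
  -- V consists of the solutions of v ^ p = 1 in the last nontrivial derived subgroup of N, a
  -- characteristic subgroup.
  by_cases hc : (⁅N, N⁆ : Subgroup G) = ⊥
  · have hcomm : ∀ a ∈ N, ∀ b ∈ N, a * b = b * a := by
      intro a ha b hb
      have : ⁅a, b⁆ ∈ (⁅N, N⁆ : Subgroup G) := Subgroup.commutator_mem_commutator ha hb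
      rw [hc, Subgroup.mem_bot, commutatorElement_eq_one_iff_mul_comm] at this
      exact this
    have hcard : Nat.card N ≠ 1 := fun h => hN (Subgroup.card_eq_one.1 h)
    obtain ⟨p, hp, hpd⟩ := Nat.exists_prime_and_dvd hcard
    have := Fact.mk hp
    obtain ⟨x, hx⟩ := exists_prime_orderOf_dvd_card' p hpd
    refine ⟨p, hp,
      { carrier := {v | v ∈ N ∧ v ^ p = 1}
        mul_mem' := ?_
        one_mem' := ?_
        inv_mem' := ?_ }, fun v hv => hv.1, ?_, fun a ha b hb => hcomm a ha.1 b hb.1,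
      fun v hv => hv.2, fun φ hφ v hv => ⟨hφ v hv.1, by rw [← map_pow, hv.2, map_one]⟩⟩
    · rintro a b ⟨ha, ha'⟩ ⟨hb, hb'⟩
      exact ⟨N.mul_mem ha hb, by rw [(show Commute a b from hcomm a ha b hb).mul_pow, ha', hb', one_mul]⟩
    · exact ⟨N.one_mem, one_pow _⟩
    · rintro a ⟨ha, ha'⟩
      exact ⟨N.inv_mem ha, by rw [inv_pow, ha', inv_one]⟩
    · intro h
      have hx1 : (x : G) ∈ (⊥ : Subgroup G) := by
        rw [← h]
        exact ⟨x.2, by rw [← Subgroup.coe_pow, ← hx, pow_orderOf_eq_one, Subgroup.coe_one]⟩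
      rw [Subgroup.mem_bot, OneMemClass.coe_eq_one] at hx1
      rw [hx1, orderOf_one] at hx
      exact hp.ne_one hx.symm
  · have hlt : ⁅N, N⁆ < N := by
      have h1 : commutator N < ⊤ := by
        have : Nontrivial N := (Subgroup.nontrivial_iff_ne_bot _).2 hN
        exact Group.IsSolvable.commutator_lt_top_of_nontrivial N
      have h2 := (Subgroup.map_subtype_lt_map_subtype (G' := N)).2 h1
      rwa [Subgroup.map_subtype_commutator, ← MonoidHom.range_eq_map, Subgroup.range_subtype] at h2
    have : Finite ↥⁅N, N⁆ := Finite.of_injective _ (Subgroup.inclusion_injective hlt.le)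
    have : Group.IsSolvable ↥⁅N, N⁆ :=
      Group.isSolvable_of_isSolvable_injective (Subgroup.inclusion_injective hlt.le)
    obtain ⟨p, hp, V, hV, hV', h1, h2, h3⟩ := ih (Nat.card ↥⁅N, N⁆) (by
      rw [← hn]
      exact Set.ncard_lt_ncard (SetLike.coe_ssubset_coe.2 hlt) (Set.toFinite (N : Set G)))
      ⁅N, N⁆ hc rfl
    refine ⟨p, hp, V, hV.trans hlt.le, hV', h1, h2, fun φ hφ => h3 φ ?_⟩
    have hmap : N.map φ.toMonoidHom ≤ N := by
      rintro _ ⟨v, hv, rfl⟩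
      exact hφ v hv
    have : (⁅N, N⁆ : Subgroup G).map φ.toMonoidHom ≤ ⁅N, N⁆ := by
      rw [Subgroup.map_commutator]
      exact Subgroup.commutator_mono hmap hmap
    exact fun x hx => this ⟨x, hx, rfl⟩

theorem IsCarter.map_mk_of_comm {G : Type*} [Group G] [Finite G] {F : Subgroup G}
    (hF : IsCarter F) {p : ℕ} [Fact p.Prime] {V : Subgroup G} [hVn : V.Normal]
    (hV : IsPGroup p V) (hcomm : ∀ a ∈ V, ∀ b ∈ V, a * b = b * a) :
    IsCarter (F.map (QuotientGroup.mk' V)) := by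
  have := hF.nilpotent
  refine ⟨Group.nilpotent_of_surjective ((QuotientGroup.mk' V).subgroupMap F)
    ((QuotientGroup.mk' V).subgroupMap_surjective F), ?_⟩
  have hmem : ∀ x : G, (x : G ⧸ V) ∈ F.map (QuotientGroup.mk' V) ↔ x ∈ F ⊔ V := by
    intro x
    have := QuotientGroup.comap_map_mk' V F
    rw [sup_comm, ← this]
    rfl
  rintro ⟨g⟩ hg
  refine (hmem g).2 (hF.mem_sup_of_conj_of_comm hV hcomm fun x hx => ?_)
  exact (hmem _).1 (hg x ((hmem x).2 hx))

theorem IsPGroup.of_pow_eq_one {G : Type*} [Group G] {p : ℕ} {V : Subgroup G}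
    (h : ∀ v ∈ V, v ^ p = 1) : IsPGroup p V :=
  isPGroup_iff_pow_pow_eq_one.2 fun v => ⟨1, Subtype.ext (by simpa using h v v.2)⟩

theorem Nat.card_quotient_lt {G : Type*} [Group G] [Finite G] {V : Subgroup G} (hV : V ≠ ⊥) :
    Nat.card (G ⧸ V) < Nat.card G := by
  rw [Subgroup.card_eq_card_quotient_mul_card_subgroup V]
  exact lt_mul_of_one_lt_right Nat.card_pos ((Subgroup.one_lt_card_iff_ne_bot V).2 hV)

/-- Factoring out an elementary abelian V ≤ N reduces the order of G, and the abelian case keeps the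
image of F Carter. Self-normalization of FN is what makes FN/N Carter in G/N. -/
theorem IsCarter.mem_sup_of_conj {G : Type*} [Group G] [Finite G] [Group.IsSolvable G]
    {F : Subgroup G} (hF : IsCarter F) {N : Subgroup G} [hNn : N.Normal] {g : G}
    (hg : ∀ x ∈ F ⊔ N, g * x * g⁻¹ ∈ F ⊔ N) : g ∈ F ⊔ N := by
  induction hn : Nat.card G using Nat.strong_induction_on generalizing G with
  | _ n ih =>
  by_cases hN : N = ⊥
  · subst hN
    rw [sup_bot_eq] at hg ⊢
    exact hF.mem_of_conj g hg
  · obtain ⟨p, hp, V, hVN, hV0, hc, hpow, hchar⟩ := exists_elementaryAbelian_le N hN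
    have := Fact.mk hp
    have hVn : V.Normal := ⟨fun v hv x => hchar (MulAut.conj x)
      (fun y hy => hNn.conj_mem y hy x) v hv⟩
    have hF' := hF.map_mk_of_comm (IsPGroup.of_pow_eq_one hpow) hc
    have hNn' : (N.map (QuotientGroup.mk' V)).Normal :=
      hNn.map _ (QuotientGroup.mk'_surjective V)
    have hmem : ∀ x : G, (x : G ⧸ V) ∈ F.map (QuotientGroup.mk' V) ⊔ N.map (QuotientGroup.mk' V)
        ↔ x ∈ F ⊔ N := by
      intro x
      have := QuotientGroup.comap_map_mk' V (F ⊔ N)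
      rw [sup_eq_right.2 (hVN.trans le_sup_right)] at this
      rw [← Subgroup.map_sup]
      conv_rhs => rw [← this]
      rfl
    refine (hmem g).1 (ih _ (by rw [← hn]; exact Nat.card_quotient_lt hV0) hF' ?_ rfl)
    rintro ⟨x⟩ hx
    exact (hmem _).2 (hg x ((hmem x).1 hx))

theorem IsCarter.map_mk {G : Type*} [Group G] [Finite G] [Group.IsSolvable G] {F : Subgroup G}
    (hF : IsCarter F) (N : Subgroup G) [N.Normal] : IsCarter (F.map (QuotientGroup.mk' N)) := by
  have := hF.nilpotent
  refine ⟨Group.nilpotent_of_surjective ((QuotientGroup.mk' N).subgroupMap F)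
    ((QuotientGroup.mk' N).subgroupMap_surjective F), ?_⟩
  have hmem : ∀ x : G, (x : G ⧸ N) ∈ F.map (QuotientGroup.mk' N) ↔ x ∈ F ⊔ N := by
    intro x
    have := QuotientGroup.comap_map_mk' N F
    rw [sup_comm, ← this]
    rfl
  rintro ⟨g⟩ hg
  refine (hmem g).2 (hF.mem_sup_of_conj fun x hx => ?_)
  exact (hmem _).1 (hg x ((hmem x).2 hx))

theorem IsCarter.subgroupOf {G : Type*} [Group G] {F : Subgroup G} (hF : IsCarter F)
    {J : Subgroup G} (hJ : F ≤ J) : IsCarter (F.subgroupOf J) := by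
  have := hF.nilpotent
  refine ⟨Group.nilpotent_of_mulEquiv (Subgroup.subgroupOfEquivOfLe hJ).symm, fun g hg => ?_⟩
  rw [Subgroup.mem_subgroupOf]
  refine hF.mem_of_conj _ fun f hf => ?_
  exact Subgroup.mem_subgroupOf.1 (hg ⟨f, hJ hf⟩ (Subgroup.mem_subgroupOf.2 hf))

/-- Fixed-point-freeness survives in FN/N without any coprimality assumption, because x ↦ x⁻¹h(x) is
bijective on F. -/
theorem IsFrobeniusCarter.map_mk {G H : Type*} [Group G] [Finite G] [Group.IsSolvable G] [Group H]
    {α : H →* MulAut G} {F : Subgroup G} (hF : IsFrobeniusCarter α F) (N : Subgroup G) [N.Normal]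
    (hN : ∀ h, ∀ x ∈ N, α h x ∈ N) :
    IsFrobeniusCarter (quotientAut α N hN) (F.map (QuotientGroup.mk' N)) := by
  refine ⟨hF.toIsCarter.map_mk N, ?_, ?_⟩
  · rintro h _ ⟨f, hf, rfl⟩
    exact ⟨α h f, hF.invariant h f hf, rfl⟩
  · rintro h hh _ ⟨f, hf, rfl⟩ hfix
    refine (QuotientGroup.eq_one_iff f).2
      (mem_of_inv_mul_apply_mem (α h).toMonoidHom F N (hF.invariant h) (hN h)
        (hF.eq_one_of_fixed h hh) hf ?_)
    exact QuotientGroup.eq.1 hfix.symm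

/-- An element of prime order r in H fixes only the identity of F, so |F| ≡ 1 modulo r. -/
theorem IsFrobeniusCarter.coprime_card {G H : Type*} [Group G] [Finite G] [Group H] [Finite H]
    {α : H →* MulAut G} {F : Subgroup G} (hF : IsFrobeniusCarter α F) :
    (Nat.card F).Coprime (Nat.card H) := by
  refine Nat.Coprime.symm (Nat.coprime_of_dvd fun r hr hrH hrF => ?_)
  have := Fact.mk hr
  obtain ⟨h, hh⟩ := exists_prime_orderOf_dvd_card' r hrH
  have hh1 : h ≠ 1 := by
    rintro rfl
    rw [orderOf_one] at hh
    exact hr.ne_one hh.symm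
  let _ : MulAction (Subgroup.zpowers h) F := MulAction.compHom F
    (((restrictAut α F hF.invariant).comp (Subgroup.zpowers h).subtype))
  have hp : IsPGroup r (Subgroup.zpowers h) := IsPGroup.of_card (n := 1) (by
    rw [Nat.card_zpowers, hh, pow_one])
  have h1 := hp.card_modEq_card_fixedPoints F
  have h2 : MulAction.fixedPoints (Subgroup.zpowers h) F = {1} := by
    ext x
    rw [MulAction.mem_fixedPoints, Set.mem_singleton_iff]
    constructor
    · intro hx
      have := hx ⟨h, Subgroup.mem_zpowers h⟩
      exact Subtype.ext (hF.eq_one_of_fixed h hh1 x x.2 (congrArg Subtype.val this))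
    · rintro rfl m
      exact map_one (restrictAut α F hF.invariant m)
  rw [h2, Nat.card_coe_set_eq, Set.ncard_singleton] at h1
  have h3 : (0 : ℕ) ≡ 1 [MOD r] := ((Nat.modEq_zero_iff_dvd.2 hrF).symm).trans h1
  exact hr.one_lt.ne' (Nat.dvd_one.1 ((Nat.modEq_zero_iff_dvd).1 h3.symm))

/-! ### Trace and norm identities for Frobenius actions on abelian groups -/

/-- A weight function summing to one on each orbit of a semiregular action away from the
identity. -/
theorem exists_weight_sum_eq_one {E H : Type*} [Group E] [Group H] [Fintype H] (c : H →* MulAut E)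
    (hfix : ∀ h, h ≠ 1 → ∀ e, c h e = e → e = 1) :
    ∃ w : E → ℕ, w 1 = 0 ∧ ∀ e, e ≠ 1 → ∑ h, w (c h⁻¹ e) = 1 := by
  classical
  let _ : MulAction H E := MulAction.compHom E c
  have hsmul : ∀ (h : H) (e : E), h • e = c h e := fun _ _ => rfl
  -- The weight is the indicator of a transversal of the nontrivial orbits. These orbits are
  -- regular, so exactly one h moves a given e ≠ 1 into the transversal.
  let r : E → E := fun e => (Quotient.mk (MulAction.orbitRel H E) e).out
  have hr : ∀ e, ∃ h : H, c h (r e) = e := by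
    intro e
    have : (MulAction.orbitRel H E) (r e) e := Quotient.exact (Quotient.out_eq _)
    obtain ⟨h, hh⟩ := MulAction.orbitRel_apply.1 ((MulAction.orbitRel H E).symm this)
    exact ⟨h, hh⟩
  have hrc : ∀ h e, r (c h e) = r e := by
    intro h e
    have : Quotient.mk (MulAction.orbitRel H E) (c h e) = Quotient.mk (MulAction.orbitRel H E) e :=
      Quotient.sound (MulAction.orbitRel_apply.2 ⟨h, rfl⟩)
    simp only [r, this]
  refine ⟨fun e => if e ≠ 1 ∧ r e = e then 1 else 0, by simp, fun e he => ?_⟩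
  obtain ⟨k, hk⟩ := hr e
  have hke : c k⁻¹ e = r e := by
    conv_lhs => rw [← hk]
    simp
  rw [Finset.sum_eq_single k]
  · refine if_pos ⟨fun h => he ?_, by rw [hrc, hke]⟩
    simpa using h
  · intro h _ hhk
    refine if_neg ?_
    rintro ⟨-, h2⟩
    rw [hrc, ← hke] at h2
    have h3 : c (h * k⁻¹) e = e := by rw [map_mul, MulAut.mul_apply, h2]; simp
    exact he (hfix _ (fun h4 => hhk (mul_inv_eq_one.1 h4)) e h3)
  · simp

/-- An explicit operator whose trace over `H`, together with the norm over `E`, is multiplication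
by the order of `E`, for a Frobenius action of `H` on `E`. -/
theorem exists_prod_mul_prod_eq_pow_card {A E H : Type*} [CommGroup A] [Group E] [Group H]
    [Fintype E] [Fintype H] (ε : E →* MulAut A) (η : H →* MulAut A) (c : H →* MulAut E)
    (hcompat : ∀ h e a, η h (ε e a) = ε (c h e) (η h a))
    (hfix : ∀ h, h ≠ 1 → ∀ e, c h e = e → e = 1) :
    ∃ T : A →* A, ∀ a, (∏ h, η h (T (η h⁻¹ a))) * ∏ e, ε e a = a ^ Fintype.card E := by
  classical
  obtain ⟨w, hw1, hw⟩ := exists_weight_sum_eq_one c hfix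
  -- Additively, T is the sum of 1 − e over representatives e of the m nontrivial H-orbits on E. Its
  -- H-conjugates add up to the sum of 1 − e over all e ≠ 1, which is |E| minus the norm.
  let m := ∑ e, w e
  let T : A →* A :=
    { toFun := fun a => a ^ m * (∏ e, ε e a ^ w e)⁻¹
      map_one' := by simp
      map_mul' := fun a b => by
        simp only [mul_pow, map_mul, Finset.prod_mul_distrib, mul_inv]
        exact mul_mul_mul_comm _ _ _ _ }
  refine ⟨T, fun a => ?_⟩
  have hm : m * Fintype.card H + 1 = Fintype.card E := by
    have h1 : m * Fintype.card H = ∑ e, ∑ h : H, w (c h⁻¹ e) := by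
      rw [Finset.sum_comm]
      have : ∀ h : H, ∑ e, w (c h⁻¹ e) = m := fun h =>
        Fintype.sum_equiv (c h⁻¹).toEquiv _ _ fun e => rfl
      simp only [this, Finset.sum_const, Finset.card_univ, smul_eq_mul, mul_comm]
    rw [h1, ← Finset.add_sum_erase _ _ (Finset.mem_univ (1 : E)),
      Finset.sum_congr rfl (fun e he => hw e (Finset.ne_of_mem_erase he))]
    simp only [map_one, hw1, Finset.sum_const_zero, zero_add, Finset.sum_const, smul_eq_mul,
      mul_one, Finset.card_erase_of_mem (Finset.mem_univ _), Finset.card_univ]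
    have := Fintype.card_pos (α := E)
    omega
  have h1 : ∀ h : H, η h (T (η h⁻¹ a)) = a ^ m * (∏ e, ε e a ^ w (c h⁻¹ e))⁻¹ := by
    intro h
    change η h ((η h⁻¹ a) ^ m * (∏ e, ε e (η h⁻¹ a) ^ w e)⁻¹) = _
    rw [map_mul, map_inv (η h), map_prod, map_pow]
    have h2 : ∀ b, η h (η h⁻¹ b) = b := fun b => by simp
    rw [h2]
    congr 2
    refine Fintype.prod_equiv (c h).toEquiv _ _ fun e => ?_
    rw [map_pow, hcompat, h2]
    change _ = ε (c h e) a ^ w (c h⁻¹ (c h e))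
    simp
  simp only [h1, Finset.prod_mul_distrib, Finset.prod_const, Finset.card_univ, Finset.prod_inv_distrib]
  rw [Finset.prod_comm]
  simp only [Finset.prod_pow_eq_pow_sum]
  rw [← Finset.mul_prod_erase _ _ (Finset.mem_univ (1 : E)),
    ← Finset.mul_prod_erase _ (fun e => ε e a) (Finset.mem_univ (1 : E)),
    Finset.prod_congr rfl (fun e he => by rw [hw e (Finset.ne_of_mem_erase he), pow_one])]
  simp only [map_one, hw1, Finset.sum_const_zero, pow_zero, one_mul, MulAut.one_apply]
  rw [← hm, pow_succ, ← pow_mul, mul_comm a, ← mul_assoc, inv_mul_cancel_right]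

/-- `Nat.gcdB m n` is an inverse of n modulo m, so n-th powers can be undone on elements of exponent
m. -/
theorem pow_eq_one_zpow_gcdB {A : Type*} [Group A] {m n : ℕ} (h : m.Coprime n) {a : A}
    (ha : a ^ m = 1) : (a ^ n) ^ Nat.gcdB m n = a := by
  have h1 := Nat.gcd_eq_gcd_ab m n
  rw [h.gcd_eq_one] at h1
  have h3 : (n : ℤ) * m.gcdB n = 1 - m * m.gcdA n := by
    have : ((1 : ℕ) : ℤ) = 1 := rfl
    linarith
  rw [← zpow_natCast, ← zpow_mul, h3, zpow_sub, zpow_one, zpow_mul, zpow_natCast, ha, one_zpow,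
    inv_one, mul_one]

/-- Crossed homomorphisms `H → A` are principal if a group `E` on which `H` acts as on a Frobenius
kernel acts compatibly on `A`, coprimely to `A`, with fixed points coprime to `H`. -/
theorem exists_eq_mul_inv_of_crossedHom {A E H : Type*} [CommGroup A] [Finite A] [Group E] [Group H]
    [Fintype E] [Fintype H] (ε : E →* MulAut A) (η : H →* MulAut A) (c : H →* MulAut E)
    (hcompat : ∀ h e a, η h (ε e a) = ε (c h e) (η h a))
    (hfix : ∀ h, h ≠ 1 → ∀ e, c h e = e → e = 1)
    (hcop : (Nat.card A).Coprime (Fintype.card E)) {M : ℕ} (hM : M.Coprime (Fintype.card H))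
    (hMfix : ∀ a, (∀ e, ε e a = a) → a ^ M = 1)
    (d : H → A) (hd : ∀ s t, d (s * t) = d s * η s (d t)) :
    ∃ u : A, ∀ s, d s = u * (η s u)⁻¹ := by
  classical
  obtain ⟨T, hT⟩ := exists_prod_mul_prod_eq_pow_card ε η c hcompat hfix
  let Nm : A →* A := ⟨⟨fun a => ∏ e, ε e a, by simp⟩, fun a b => by
    simp [Finset.prod_mul_distrib]⟩
  have hNm : ∀ a, Nm a = ∏ e, ε e a := fun a => rfl
  have hNη : ∀ h a, Nm (η h a) = η h (Nm a) := by
    intro h a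
    rw [hNm, hNm, map_prod]
    refine (Fintype.prod_equiv (c h).toEquiv _ _ fun e => ?_).symm
    exact hcompat h e a
  have hNε : ∀ e a, ε e (Nm a) = Nm a := by
    intro e a
    rw [hNm, map_prod]
    refine Fintype.prod_equiv (Equiv.mulLeft e) _ _ fun x => ?_
    simp
  -- By `hT`, d raised to the power |E| splits into a trace part and a norm part. The cocycle
  -- identity makes the trace part the coboundary of u₀. The norm part takes values of exponent M,
  -- prime to |H|, so averaging over H trivializes it by a power of w. Finally |E| is inverted
  -- modulo |A|.
  let u₀ : A := ∏ h, η h (T (η h⁻¹ (d h)))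
  let w : A := ∏ h, Nm (d h)
  have h1 : ∀ s, ∏ h, η h (T (η h⁻¹ (d s))) = u₀ * (η s u₀)⁻¹ := by
    intro s
    have h2 : ∀ h, η h (T (η h⁻¹ (d s))) =
        η h (T (η h⁻¹ (d h))) * (η h (T (η h⁻¹ (η s (d (s⁻¹ * h))))))⁻¹ := by
      intro h
      have : d h = d s * η s (d (s⁻¹ * h)) := by rw [← hd, mul_inv_cancel_left]
      rw [eq_mul_inv_iff_mul_eq, ← map_mul, ← map_mul, ← map_mul, ← this]
    rw [Finset.prod_congr rfl fun h _ => h2 h, Finset.prod_mul_distrib, Finset.prod_inv_distrib]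
    congr 2
    rw [map_prod]
    refine (Fintype.prod_equiv (Equiv.mulLeft s) _ _ fun h => ?_).symm
    simp [map_mul]
  have h2 : ∀ s, Nm (d s) ^ Fintype.card H = w * (η s w)⁻¹ := by
    intro s
    rw [eq_mul_inv_iff_mul_eq]
    have : ∀ t, Nm (d (s * t)) = Nm (d s) * η s (Nm (d t)) := fun t => by rw [hd, map_mul, hNη]
    calc Nm (d s) ^ Fintype.card H * η s w = ∏ t, Nm (d (s * t)) := by
          simp only [this, Finset.prod_mul_distrib, Finset.prod_const, Finset.card_univ, w, map_prod]
      _ = w := Fintype.prod_equiv (Equiv.mulLeft s) _ _ fun h => rfl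
  have h3 : ∀ s, Nm (d s) = (w * (η s w)⁻¹) ^ Nat.gcdB M (Fintype.card H) := by
    intro s
    rw [← h2, pow_eq_one_zpow_gcdB hM (hMfix _ fun e => hNε e _)]
  refine ⟨(u₀ * w ^ Nat.gcdB M (Fintype.card H)) ^ Nat.gcdB (Nat.card A) (Fintype.card E),
    fun s => ?_⟩
  rw [← pow_eq_one_zpow_gcdB hcop (a := d s) pow_card_eq_one', ← hT, h1, ← hNm, h3, map_zpow,
    ← inv_zpow, ← mul_zpow, map_mul, map_zpow]
  congr 1
  rw [mul_zpow, inv_zpow, mul_inv, mul_mul_mul_comm]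

/-- If a Frobenius group with kernel `E` and complement `H` acts on an abelian group and the trace
over `H` vanishes, then the norm over `E` is multiplication by the order of `E`. -/
theorem prod_eq_pow_card_of_prod_eq_one {A E H : Type*} [CommGroup A] [Group E] [Group H]
    [Fintype E] [Fintype H] (ε : E →* MulAut A) (η : H →* MulAut A) (c : H →* MulAut E)
    (hcompat : ∀ h e a, η h (ε e a) = ε (c h e) (η h a))
    (hfix : ∀ h, h ≠ 1 → ∀ e, c h e = e → e = 1) (hprod : ∀ a, ∏ h, η h a = 1) (a : A) :
    ∏ e, ε e a = a ^ Fintype.card E := by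
  classical
  -- Additively, expand the vanishing sum of e(∑ h)e⁻¹ over E. For h ≠ 1 the map e ↦ e·c_h(e)⁻¹
  -- permutes E, so the terms with h give the norm of h(a). Comparison with the norm of the
  -- vanishing trace leaves only h = 1.
  have h1 : ∀ h : H, h ≠ 1 → ∏ e, ε e (η h (ε e⁻¹ a)) = ∏ e, ε e (η h a) := by
    intro h hh
    have hinj : Function.Injective fun e : E => e * (c h e)⁻¹ := by
      intro e f hef
      have h2 : c h (f⁻¹ * e) = f⁻¹ * e := by
        have : e * (c h e)⁻¹ = f * (c h f)⁻¹ := hef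
        rw [map_mul, map_inv, ← inv_mul_eq_iff_eq_mul.2 (mul_inv_eq_iff_eq_mul.1 this)]
        group
      exact (inv_mul_eq_one.1 (hfix h hh _ h2)).symm
    refine Fintype.prod_equiv (Equiv.ofBijective _ (Finite.injective_iff_bijective.1 hinj)) _ _
      fun e => ?_
    rw [hcompat]
    simp
  have h2 : ∏ h : H, ∏ e, ε e (η h (ε e⁻¹ a)) = 1 := by
    rw [Finset.prod_comm]
    simp only [← map_prod, hprod, map_one, Finset.prod_const_one]
  have h3 : ∏ h : H, ∏ e, ε e (η h a) = 1 := by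
    rw [Finset.prod_comm]
    simp only [← map_prod, hprod, map_one, Finset.prod_const_one]
  rw [← Finset.mul_prod_erase _ _ (Finset.mem_univ (1 : H)),
    Finset.prod_congr rfl (fun h hh => h1 h (Finset.ne_of_mem_erase hh))] at h2
  rw [← Finset.mul_prod_erase _ _ (Finset.mem_univ (1 : H)), ← h2] at h3
  have h4 := mul_right_cancel h3
  simpa using h4

/-! ### Lifting fixed points, and the case of no fixed points -/

/-- The Hall `p'`-subgroup of a Frobenius Carter subgroup. -/
theorem IsFrobeniusCarter.exists_hall {G H : Type*} [Group G] [Finite G] [Group H]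
    {α : H →* MulAut G} {F : Subgroup G} (hF : IsFrobeniusCarter α F) (p : ℕ) [Fact p.Prime] :
    ∃ E : Subgroup G, (∀ x, x ∈ E ↔ x ∈ F ∧ (orderOf x).Coprime p) ∧ (∀ h, ∀ e ∈ E, α h e ∈ E) ∧
      (Nat.card E).Coprime p := by
  have := hF.nilpotent
  obtain ⟨E, hE⟩ := exists_subgroup_mem_iff_coprime_orderOf F p
  refine ⟨E, hE, fun h e he => (hE _).2 ⟨hF.invariant h e ((hE e).1 he).1, ?_⟩,
    coprime_card_of_coprime_orderOf fun x => ?_⟩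
  · rw [MulEquiv.orderOf_eq]; exact ((hE e).1 he).2
  · rw [← Subgroup.orderOf_coe]; exact ((hE x).1 x.2).2

section

variable {G H : Type*} [Group G] [Finite G] [Group H] [Finite H] {α : H →* MulAut G}
  {F : Subgroup G}

/-- The map h ↦ g⁻¹h(g) is a crossed homomorphism H → V, and writing it as a coboundary yields v.
The vanishing criterion applies with E the Hall p'-subgroup of F: C_V(E) ≤ F, so its exponent
divides |F|, which is prime to |H|. -/
theorem IsFrobeniusCarter.exists_mul_mem_fixed_of_comm (hF : IsFrobeniusCarter α F) {p : ℕ}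
    [Fact p.Prime] {V : Subgroup G} [hVn : V.Normal] (hV : IsPGroup p V)
    (hcomm : ∀ a ∈ V, ∀ b ∈ V, a * b = b * a) (hVα : ∀ h, ∀ v ∈ V, α h v ∈ V) {g : G}
    (hg : ∀ h, g⁻¹ * α h g ∈ V) : ∃ v ∈ V, g * v ∈ fixedSubgroup α := by
  classical
  obtain ⟨E, hE, hEα, hEp⟩ := hF.exists_hall p
  have : Fintype E := Fintype.ofFinite _
  have : Fintype H := Fintype.ofFinite _
  let _ : CommGroup V := { (inferInstance : Group V) with
    mul_comm := fun a b => Subtype.ext (hcomm a a.2 b b.2) }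
  obtain ⟨u, hu⟩ := exists_eq_mul_inv_of_crossedHom (A := V)
    ((MulAut.conjNormal (H := V)).comp E.subtype) (restrictAut α V hVα) (restrictAut α E hEα)
    (fun h e a => Subtype.ext (by simp [MulAut.conjNormal_apply]))
    (fun h hh e he => Subtype.ext (hF.eq_one_of_fixed h hh e ((hE e).1 e.2).1
      (congrArg Subtype.val he)))
    (by
      obtain ⟨n, hn⟩ := IsPGroup.iff_card.1 hV
      rw [hn, ← Nat.card_eq_fintype_card]
      exact (hEp.pow_right n).symm)
    (M := Nat.card F) (by rw [← Nat.card_eq_fintype_card]; exact hF.coprime_card)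
    (fun a ha => by
      have haF : (a : G) ∈ F := by
        refine hF.mem_of_commute hE hV (fun f _ v hv => hVn.conj_mem v hv f) a.2 fun e he => ?_
        have := congrArg Subtype.val (ha ⟨e, he⟩)
        exact mul_inv_eq_iff_eq_mul.1 this
      have : (⟨a, haF⟩ : F) ^ Nat.card F = 1 := pow_card_eq_one'
      have h : (a : G) ^ Nat.card F = 1 := congrArg Subtype.val this
      exact Subtype.ext h)
    (fun h => ⟨g⁻¹ * α h g, hg h⟩)
    (fun s t => Subtype.ext (by simp [mul_assoc]))
  refine ⟨u, u.2, fun h => ?_⟩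
  have h1 : g⁻¹ * α h g = u * (α h u)⁻¹ := congrArg Subtype.val (hu h)
  have h2 : α h g = g * (u * (α h u)⁻¹) := by rw [← h1, mul_inv_cancel_left]
  rw [map_mul, h2]
  group

/-- Traces over H lie in C_V(H) = 1, so v to the power |E| is a norm over E, hence centralized by E
and contained in F. As |E| is prime to p, so is v. -/
theorem IsFrobeniusCarter.le_of_inf_fixedSubgroup_eq_bot (hF : IsFrobeniusCarter α F) {p : ℕ}
    [Fact p.Prime] {V : Subgroup G} [hVn : V.Normal] (hV : IsPGroup p V)
    (hcomm : ∀ a ∈ V, ∀ b ∈ V, a * b = b * a) (hVα : ∀ h, ∀ v ∈ V, α h v ∈ V)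
    (hfix : V ⊓ fixedSubgroup α = ⊥) : V ≤ F := by
  classical
  obtain ⟨E, hE, hEα, hEp⟩ := hF.exists_hall p
  have : Fintype E := Fintype.ofFinite _
  have : Fintype H := Fintype.ofFinite _
  let _ : CommGroup V := { (inferInstance : Group V) with
    mul_comm := fun a b => Subtype.ext (hcomm a a.2 b b.2) }
  let η := restrictAut α V hVα
  let ε : E →* MulAut V := (MulAut.conjNormal (H := V)).comp E.subtype
  have hprod : ∀ a : V, ∏ h, η h a = 1 := by
    intro a
    have hmem : ((∏ h, η h a : V) : G) ∈ V ⊓ fixedSubgroup α := by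
      refine ⟨Subtype.prop _, fun s => ?_⟩
      have : η s (∏ h, η h a) = ∏ h, η h a := by
        rw [map_prod]
        refine Fintype.prod_equiv (Equiv.mulLeft s) _ _ fun h => ?_
        rw [Equiv.coe_mulLeft, map_mul, MulAut.mul_apply]
      exact congrArg Subtype.val this
    rw [hfix, Subgroup.mem_bot] at hmem
    exact Subtype.ext hmem
  intro v hv
  have h2 := prod_eq_pow_card_of_prod_eq_one ε η (restrictAut α E hEα)
    (fun h e a => Subtype.ext (by simp [ε, η, MulAut.conjNormal_apply]))
    (fun h hh e he => Subtype.ext (hF.eq_one_of_fixed h hh e ((hE e).1 e.2).1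
      (congrArg Subtype.val he))) hprod ⟨v, hv⟩
  have h3 : v ^ Fintype.card E ∈ F := by
    refine hF.mem_of_commute hE hV (fun f _ v hv => hVn.conj_mem v hv f) (V.pow_mem hv _)
      fun e he => ?_
    have h4 : ε ⟨e, he⟩ (∏ e, ε e ⟨v, hv⟩) = ∏ e, ε e ⟨v, hv⟩ := by
      rw [map_prod]
      refine Fintype.prod_equiv (Equiv.mulLeft ⟨e, he⟩) _ _ fun x => ?_
      rw [Equiv.coe_mulLeft, map_mul, MulAut.mul_apply]
    rw [h2] at h4
    exact mul_inv_eq_iff_eq_mul.1 (congrArg Subtype.val h4)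
  have h5 : v ^ Nat.card V = 1 := by
    have : (⟨v, hv⟩ : V) ^ Nat.card V = 1 := pow_card_eq_one'
    exact congrArg Subtype.val this
  rw [← pow_eq_one_zpow_gcdB (n := Fintype.card E) (by
      obtain ⟨n, hn⟩ := IsPGroup.iff_card.1 hV
      rw [hn, ← Nat.card_eq_fintype_card]
      exact (hEp.pow_right n).symm) h5]
  exact F.zpow_mem h3 _

/-- Fixed points lift modulo invariant normal subgroups. -/
theorem IsFrobeniusCarter.exists_mul_mem_fixed [Group.IsSolvable G] (hF : IsFrobeniusCarter α F)
    {N : Subgroup G} [hNn : N.Normal] (hNα : ∀ h, ∀ v ∈ N, α h v ∈ N) {g : G}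
    (hg : ∀ h, g⁻¹ * α h g ∈ N) : ∃ n ∈ N, g * n ∈ fixedSubgroup α := by
  induction hn : Nat.card G using Nat.strong_induction_on generalizing G with
  | _ n ih =>
  by_cases hN : N = ⊥
  · subst hN
    refine ⟨1, Subgroup.one_mem _, fun h => ?_⟩
    rw [mul_one]
    exact (inv_mul_eq_one.1 (Subgroup.mem_bot.1 (hg h))).symm
  · obtain ⟨p, hp, V, hVN, hV0, hc, hpow, hchar⟩ := exists_elementaryAbelian_le N hN
    have := Fact.mk hp
    have hVn : V.Normal := ⟨fun v hv x => hchar (MulAut.conj x)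
      (fun y hy => hNn.conj_mem y hy x) v hv⟩
    have hVα : ∀ h, ∀ v ∈ V, α h v ∈ V := fun h => hchar (α h) (hNα h)
    have hNn' : (N.map (QuotientGroup.mk' V)).Normal :=
      hNn.map _ (QuotientGroup.mk'_surjective V)
    obtain ⟨_, ⟨m, hm, rfl⟩, hfix⟩ := ih _ (by rw [← hn]; exact Nat.card_quotient_lt hV0)
      (hF.map_mk V hVα) (N := N.map (QuotientGroup.mk' V)) (g := (g : G ⧸ V))
      (by
        rintro h _ ⟨v, hv, rfl⟩
        exact ⟨α h v, hNα h v hv, rfl⟩)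
      (fun h => ⟨g⁻¹ * α h g, hg h, rfl⟩) rfl
    obtain ⟨v, hv, hgv⟩ := hF.exists_mul_mem_fixed_of_comm (IsPGroup.of_pow_eq_one hpow) hc hVα
      (g := g * m) (fun h => QuotientGroup.eq.1 (hfix h).symm)
    exact ⟨m * v, N.mul_mem hm (hVN hv), by rwa [← mul_assoc]⟩

/-- A characteristic elementary abelian V lies in F, and G/V again has no nontrivial fixed points
because they lift; induction on the order applies. -/
theorem IsFrobeniusCarter.eq_top_of_fixedSubgroup_eq_bot [Group.IsSolvable G]
    (hF : IsFrobeniusCarter α F) (hfix : fixedSubgroup α = ⊥) : F = ⊤ := by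
  induction hn : Nat.card G using Nat.strong_induction_on generalizing G with
  | _ n ih =>
  by_cases hG : (⊤ : Subgroup G) = ⊥
  · rw [eq_top_iff, hG]
    exact bot_le
  · obtain ⟨p, hp, V, -, hV0, hc, hpow, hchar⟩ := exists_elementaryAbelian_le ⊤ hG
    have := Fact.mk hp
    have hVn : V.Normal := ⟨fun v hv x => hchar (MulAut.conj x) (fun _ _ => trivial) v hv⟩
    have hVα : ∀ h, ∀ v ∈ V, α h v ∈ V := fun h => hchar (α h) (fun _ _ => trivial)
    have hVF : V ≤ F := hF.le_of_inf_fixedSubgroup_eq_bot (IsPGroup.of_pow_eq_one hpow) hc hVα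
      (by rw [hfix, inf_bot_eq])
    have h1 := ih _ (by rw [← hn]; exact Nat.card_quotient_lt hV0) (hF.map_mk V hVα) (by
      rw [eq_bot_iff]
      rintro ⟨g⟩ hg
      obtain ⟨v, hv, hgv⟩ := hF.exists_mul_mem_fixed hVα (g := g)
        (fun h => QuotientGroup.eq.1 (hg h).symm)
      rw [hfix, Subgroup.mem_bot] at hgv
      refine Subgroup.mem_bot.2 ((QuotientGroup.eq_one_iff g).2 ?_)
      rw [eq_inv_of_mul_eq_one_left hgv]
      exact V.inv_mem hv) rfl
    have h2 := QuotientGroup.comap_map_mk' V F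
    rw [h1, Subgroup.comap_top, sup_eq_right.2 hVF] at h2
    exact h2.symm

end

/-! ### Linear actions: weight spaces and their stabilizers -/

theorem LinearEquiv.mem_smul_submodule_iff {k W : Type*} [Field k] [AddCommGroup W] [Module k W]
    {g : W ≃ₗ[k] W} {U : Submodule k W} {w : W} : w ∈ g • U ↔ g⁻¹ w ∈ U := by
  constructor
  · intro h
    have := Submodule.smul_mem_pointwise_smul w g⁻¹ _ h
    rwa [inv_smul_smul] at this
  · intro h
    have := Submodule.smul_mem_pointwise_smul (g⁻¹ w) g _ h
    have h2 : g • (g⁻¹ w) = w := smul_inv_smul g w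
    rwa [h2] at this

/-- Simultaneous eigenspaces of a finite-exponent commutative group of linear automorphisms. -/
theorem exists_weightSpaces {k W : Type*} [Field k] [IsAlgClosed k] [AddCommGroup W] [Module k W]
    [FiniteDimensional k W] (A : Subgroup (W ≃ₗ[k] W)) (hcomm : ∀ a ∈ A, ∀ b ∈ A, a * b = b * a)
    (hpow : ∀ a ∈ A, ∃ n : ℕ, a ^ n = 1 ∧ (n : k) ≠ 0) :
    ∃ S : Set (Submodule k W), sSup S = ⊤ ∧ sSupIndep S ∧ ⊥ ∉ S ∧
      (∀ U ∈ S, ∀ a ∈ A, ∃ c : k, ∀ w ∈ U, a w = c • w) ∧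
      (∀ g : W ≃ₗ[k] W, (∀ a ∈ A, g * a * g⁻¹ ∈ A) → (∀ a ∈ A, g⁻¹ * a * g ∈ A) →
        ∀ U ∈ S, g • U ∈ S) ∧
      ∀ g : W ≃ₗ[k] W, (∀ a ∈ A, g * a = a * g) → ∀ U ∈ S, ∀ w ∈ U, g w ∈ U := by
  classical
  let fn : A → Module.End k W := fun a => (a : W ≃ₗ[k] W).toLinearMap
  let wt : (A → k) → Submodule k W := fun χ => ⨅ a, (fn a).eigenspace (χ a)
  have hwt : ∀ χ w, w ∈ wt χ ↔ ∀ a : A, (a : W ≃ₗ[k] W) w = χ a • w := by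
    intro χ w
    simp [wt, fn]
  have hss : ∀ a : A, (fn a).IsSemisimple := by
    intro a
    obtain ⟨n, hn, hn0⟩ := hpow a a.2
    refine Module.End.isSemisimple_of_squarefree_aeval_eq_zero (p := Polynomial.X ^ n - 1) ?_ ?_
    · exact (Polynomial.separable_X_pow_sub_C (1 : k) hn0 one_ne_zero).squarefree
    · have : fn a ^ n = 1 := by
        have h2 : ∀ m : ℕ, fn a ^ m = ((a : W ≃ₗ[k] W) ^ m).toLinearMap := by
          intro m
          induction m with
          | zero => rfl
          | succ m ih => rw [pow_succ, pow_succ, ih]; rfl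
        rw [h2, hn]; rfl
      simp [this]
  have hmax : ∀ (a : A) (c : k), (fn a).maxGenEigenspace c = (fn a).eigenspace c := fun a c =>
    (hss a).isFinitelySemisimple.maxGenEigenspace_eq_eigenspace c
  have hcm : ∀ a b : A, Commute (fn a) (fn b) := by
    intro a b
    have := hcomm a a.2 b b.2
    ext w
    exact congrArg (fun g : W ≃ₗ[k] W => g w) this
  have hind : iSupIndep wt := by
    have := Module.End.independent_iInf_maxGenEigenspace_of_forall_mapsTo fn
      (fun i j φ => Module.End.mapsTo_maxGenEigenspace_of_comm (hcm j i) φ)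
    simpa only [hmax] using this
  have htop : ⨆ χ, wt χ = ⊤ := by
    have := Module.End.iSup_iInf_maxGenEigenspace_eq_top_of_iSup_maxGenEigenspace_eq_top_of_commute
      fn (fun a b _ => hcm a b) (fun a => Module.End.iSup_maxGenEigenspace_eq_top (fn a))
    simpa only [hmax] using this
  refine ⟨Set.range wt \ {⊥}, ?_, ?_, by simp, ?_, ?_, ?_⟩
  · rw [sSup_sdiff_singleton_bot, sSup_range, htop]
  · exact (hind.sSupIndep_range).mono Set.sdiff_subset
  · rintro _ ⟨⟨χ, rfl⟩, -⟩ a ha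
    exact ⟨χ ⟨a, ha⟩, fun w hw => (hwt χ w).1 hw ⟨a, ha⟩⟩
  · rintro g hg hg' _ ⟨⟨χ, rfl⟩, hU⟩
    refine ⟨⟨fun a => χ ⟨g⁻¹ * a * g, hg' a a.2⟩, ?_⟩, fun h => hU ?_⟩
    · ext w
      rw [LinearEquiv.mem_smul_submodule_iff, hwt, hwt]
      constructor
      · intro h a
        have := h ⟨g * a * g⁻¹, hg a a.2⟩
        have h2 : (⟨g⁻¹ * (g * a * g⁻¹) * g, hg' _ (hg a a.2)⟩ : A) = a :=
          Subtype.ext (by simp [mul_assoc])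
        simp only [h2] at this
        have h3 := congrArg (g⁻¹ : W ≃ₗ[k] W) this
        rw [map_smul] at h3
        rw [← h3]
        change a.1 (g⁻¹ w) = (g⁻¹ * (g * a * g⁻¹)) w
        rw [show g⁻¹ * (g * (a : W ≃ₗ[k] W) * g⁻¹) = a * g⁻¹ by group]
        rfl
      · intro h a
        have := h ⟨g⁻¹ * a * g, hg' a a.2⟩
        have h3 := congrArg g this
        rw [map_smul] at h3
        change (g * (g⁻¹ * a * g) * g⁻¹) w = _ • (g * g⁻¹) w at h3
        rw [show g * (g⁻¹ * (a : W ≃ₗ[k] W) * g) * g⁻¹ = a by group, mul_inv_cancel] at h3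
        exact h3
    · have := congrArg (g⁻¹ • ·) (Set.mem_singleton_iff.1 h)
      simpa using this
  · rintro g hg _ ⟨⟨χ, rfl⟩, -⟩ w hw
    rw [hwt] at hw ⊢
    intro a
    have := congrArg (fun g : W ≃ₗ[k] W => g w) (hg a a.2)
    change g (a.1 w) = a.1 (g w) at this
    rw [← this, hw, map_smul]

/-- If the stabilizer of `U` in `H` is trivial, then `U` embeds in the fixed points of `H` on the
sum of its translates. -/
theorem apply_eq_self_of_stabilizer_eq_one {k W H : Type*} [Field k] [AddCommGroup W] [Module k W]
    [Group H] [Fintype H] (σ : H →* (W ≃ₗ[k] W)) {S : Set (Submodule k W)} (hS : sSupIndep S)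
    {U : Submodule k W} (hU : ∀ h, σ h • U ∈ S) (hstab : ∀ h, σ h • U = U → h = 1)
    {y : W ≃ₗ[k] W} (hy : ∀ h, σ h * y = y * σ h) (hyU : ∀ w ∈ U, y w ∈ U)
    (htr : ∀ w, y (∑ h, σ h w) = ∑ h, σ h w) {w : W} (hw : w ∈ U) : y w = w := by
  classical
  have hinj : Function.Injective fun h : H => (⟨σ h • U, hU h⟩ : S) := by
    intro a b hab
    have h1 : σ a • U = σ b • U := congrArg Subtype.val hab
    have h2 : σ (b⁻¹ * a) • U = U := by
      rw [map_mul, mul_smul, h1, map_inv, inv_smul_smul]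
    exact (inv_mul_eq_one.1 (hstab _ h2)).symm
  have hind := ((sSupIndep_iff S).1 hS).comp hinj
  -- Since y fixes traces and commutes with H, the vectors σ h (y w − w) sum to zero. They lie in
  -- distinct independent translates of U, so each is zero.
  have h0 := (iSupIndep_iff_finsetSum_eq_zero_imp_eq_zero _).1 hind Finset.univ
    (fun h => σ h (y w - w))
    (fun h _ => Submodule.smul_mem_pointwise_smul _ (σ h) U (U.sub_mem (hyU w hw) hw)) (by
      simp only [map_sub, Finset.sum_sub_distrib]
      have : ∀ h, σ h (y w) = y (σ h w) := fun h =>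
        congrArg (fun g : W ≃ₗ[k] W => g w) (hy h)
      simp only [this, ← map_sum, htr, sub_self]) 1 (Finset.mem_univ _)
  simpa [sub_eq_zero] using h0

section

variable {k W G H : Type*} [Field k] [AddCommGroup W] [Module k W]
  [Group G] [Finite G] [Group H] {α : H →* MulAut G} {F : Subgroup G}

/-- Given a subspace `U` stabilized by a nontrivial element of `H`, every translate of `U` under `F`
other than `U` has trivial stabilizer in `H`. -/
theorem IsFrobeniusCarter.stabilizer_eq_one_of_smul_ne [Finite H] (hF : IsFrobeniusCarter α F)
    (ρ : G →* (W ≃ₗ[k] W)) (σ : H →* (W ≃ₗ[k] W)) (hρσ : ∀ h g, σ h * ρ g = ρ (α h g) * σ h)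
    {U : Submodule k W} {h₁ : H} (hh₁ : h₁ ≠ 1) (hU : σ h₁ • U = U) {f : G} (hf : f ∈ F)
    (hfU : ρ f • U ≠ U) {h : H} (hh : σ h • ρ f • U = ρ f • U) : h = 1 := by
  have := hF.nilpotent
  have hsw : ∀ h g (V : Submodule k W), σ h • ρ g • V = ρ (α h g) • σ h • V := fun h g V => by
    rw [smul_smul, smul_smul, hρσ]
  -- H₂ stabilizes the F-orbit of U. It acts coprimely on the image of F, so Glauberman's lemma
  -- gives a translate f₀U fixed by all of H₂.
  let H₂ : Subgroup H :=
    { carrier := {h | ∃ f ∈ F, σ h • U = ρ f • U}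
      one_mem' := ⟨1, F.one_mem, by simp⟩
      mul_mem' := by
        rintro a b ⟨f, hf, ha⟩ ⟨g, hg, hb⟩
        refine ⟨α a g * f, F.mul_mem (hF.invariant _ _ hg) hf, ?_⟩
        rw [map_mul, mul_smul, hb, hsw, ha, map_mul, mul_smul]
      inv_mem' := by
        rintro a ⟨f, hf, ha⟩
        refine ⟨(α a⁻¹ f)⁻¹, F.inv_mem (hF.invariant _ _ hf), ?_⟩
        rw [map_inv ρ, eq_inv_smul_iff, ← hsw, ← ha, map_inv, inv_smul_smul] }
  have hH₂ : ∀ h, h ∈ H₂ ↔ ∃ f ∈ F, σ h • U = ρ f • U := fun h => Iff.rfl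
  have hsolv : Group.IsSolvable (F.map ρ) :=
    Group.isSolvable_of_surjective (ρ.subgroupMap_surjective F)
  have : Finite (F.map ρ) := Finite.of_surjective _ (ρ.subgroupMap_surjective F)
  have : Finite (H₂.map σ) := Finite.of_surjective _ (σ.subgroupMap_surjective H₂)
  obtain ⟨_, ⟨f₀, hf₀, rfl⟩, hfix⟩ := exists_smul_fixed_of_coprime (H₂.map σ) (F.map ρ) U
    (by
      rintro _ ⟨h, -, rfl⟩ _ ⟨f, hf, rfl⟩
      refine ⟨α h f, hF.invariant h f hf, ?_⟩
      rw [hρσ, mul_inv_cancel_right])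
    (by
      rintro _ ⟨h, ⟨f, hf, hfh⟩, rfl⟩
      exact ⟨ρ f, ⟨f, hf, rfl⟩, hfh⟩)
    (Nat.Coprime.coprime_dvd_left (Subgroup.card_dvd_of_surjective _ (ρ.subgroupMap_surjective F))
      (Nat.Coprime.coprime_dvd_right ((Subgroup.card_dvd_of_surjective _
        (σ.subgroupMap_surjective H₂)).trans (Subgroup.card_subgroup_dvd_card H₂)) hF.coprime_card))
  have hfix' : ∀ h ∈ H₂, σ h • ρ f₀ • U = ρ f₀ • U := fun h hh => hfix _ ⟨h, hh, rfl⟩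
  -- If h ≠ 1 fixes fU, it also fixes f₀U, so the stabilizer of f₀U is h-invariant;
  -- fixed-point-freeness on F then gives fU = f₀U. At most one translate has a nontrivial
  -- stabilizer in H.
  have huniq : ∀ f ∈ F, ∀ h, h ≠ 1 → σ h • ρ f • U = ρ f • U → ρ f • U = ρ f₀ • U := by
    intro f hf h hh hfU
    have hmem : h ∈ H₂ := by
      refine ⟨(α h f)⁻¹ * f, F.mul_mem (F.inv_mem (hF.invariant h f hf)) hf, ?_⟩
      rw [map_mul, map_inv, mul_smul, eq_inv_smul_iff, ← hsw, hfU]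
    have h0 := hfix' h hmem
    let K : Subgroup G := (MulAction.stabilizer (W ≃ₗ[k] W) (ρ f₀ • U)).comap ρ
    have hK : ∀ g, g ∈ K ↔ ρ g • ρ f₀ • U = ρ f₀ • U := fun g => Iff.rfl
    have hfe : ρ (f * f₀⁻¹) • ρ f₀ • U = ρ f • U := by
      rw [smul_smul, ← map_mul, inv_mul_cancel_right]
    have h3 : f * f₀⁻¹ ∈ K := by
      refine mem_of_inv_mul_apply_mem (α h).toMonoidHom F K (hF.invariant h) ?_
        (hF.eq_one_of_fixed h hh) (F.mul_mem hf (F.inv_mem hf₀)) ?_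
      · intro g hg
        rw [hK] at hg ⊢
        change ρ (α h g) • _ = _
        have := hsw h g (ρ f₀ • U)
        rw [hg, h0] at this
        exact this.symm
      · rw [hK, map_mul, mul_smul, map_inv, inv_smul_eq_iff, hfe]
        have := hsw h (f * f₀⁻¹) (ρ f₀ • U)
        rw [hfe, hfU, h0] at this
        exact this.symm
    rw [hK, hfe] at h3
    exact h3
  by_contra hne
  have h1 := huniq 1 F.one_mem h₁ hh₁ (by simpa using hU)
  have h2 := huniq f hf h hne hh
  rw [map_one, one_smul] at h1
  exact hfU (h2.trans h1.symm)

/-- An element of `G` acting as a scalar on the sum of the `F`-translates of a subspace `U`, which is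
stabilized by a nontrivial element of `H`, acts trivially there. -/
theorem IsFrobeniusCarter.scalar_eq_one [Group.IsSolvable G] (hF : IsFrobeniusCarter α F)
    (ρ : G →* (W ≃ₗ[k] W)) (σ : H →* (W ≃ₗ[k] W)) (hρσ : ∀ h g, σ h * ρ g = ρ (α h g) * σ h)
    {U : Submodule k W} (hU0 : U ≠ ⊥) {h₁ : H} (hh₁ : h₁ ≠ 1) (hU : σ h₁ • U = U) {y : G} {c : k}
    (hy : ∀ f ∈ F, ∀ w ∈ ρ f • U, ρ y w = c • w) : c = 1 := by
  have hmv : ∀ {V : Submodule k W} {g : W ≃ₗ[k] W} {w : W}, w ∈ V → g w ∈ g • V :=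
    fun {V g w} hw => Submodule.smul_mem_pointwise_smul w g V hw
  have hsw : ∀ h g (V : Submodule k W), σ h • ρ g • V = ρ (α h g) • σ h • V := fun h g V => by
    rw [smul_smul, smul_smul, hρσ]
  -- K is the pointwise stabilizer of all F-translates of U. Since y acts there as a scalar, it
  -- normalizes K and commutes with F modulo K.
  let K : Subgroup G :=
    { carrier := {g | ∀ f ∈ F, ∀ w ∈ ρ f • U, ρ g w = w}
      one_mem' := by intro f _ w _; rw [map_one]; rfl
      mul_mem' := by
        intro a b ha hb f hf w hw
        rw [map_mul]
        change ρ a (ρ b w) = w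
        rw [hb f hf w hw, ha f hf w hw]
      inv_mem' := by
        intro a ha f hf w hw
        conv_lhs => rw [← ha f hf w hw]
        rw [map_inv]
        exact LinearEquiv.symm_apply_apply (ρ a) w }
  have hK : ∀ g, g ∈ K ↔ ∀ f ∈ F, ∀ w ∈ ρ f • U, ρ g w = w := fun g => Iff.rfl
  let J : Subgroup G := Subgroup.normalizer (K : Set G)
  have hFK : ∀ g ∈ F, ∀ x ∈ K, g * x * g⁻¹ ∈ K := by
    intro g hg x hx f hf w hw
    have h1 : ρ g⁻¹ w ∈ ρ (g⁻¹ * f) • U := by rw [map_mul, mul_smul]; exact hmv hw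
    have h2 := hx _ (F.mul_mem (F.inv_mem hg) hf) _ h1
    rw [map_mul, map_mul]
    change ρ g (ρ x (ρ g⁻¹ w)) = w
    rw [h2, map_inv]
    exact LinearEquiv.apply_symm_apply (ρ g) w
  have hFJ : F ≤ J := by
    intro g hg
    refine Subgroup.mem_normalizer_iff.2 fun x => ⟨hFK g hg x, fun h => ?_⟩
    have := hFK g⁻¹ (F.inv_mem hg) _ h
    rwa [show g⁻¹ * (g * x * g⁻¹) * g⁻¹⁻¹ = x by group] at this
  have hc0 : c ≠ 0 := by
    rintro rfl
    refine hU0 (eq_bot_iff.2 fun w hw => ?_)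
    have := hy 1 F.one_mem w (by simpa using hw)
    rw [zero_smul] at this
    simpa using this
  have hyinv : ∀ f ∈ F, ∀ w ∈ ρ f • U, ρ y⁻¹ w = c⁻¹ • w := by
    intro f hf w hw
    have h1 := hy f hf w hw
    have h2 : ρ y⁻¹ (ρ y w) = w := by
      rw [map_inv]; exact LinearEquiv.symm_apply_apply (ρ y) w
    rw [h1, map_smul] at h2
    rw [eq_inv_smul_iff₀ hc0, h2]
  have hconj : ∀ {y : G} {c : k}, c ≠ 0 → (∀ f ∈ F, ∀ w ∈ ρ f • U, ρ y w = c • w) →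
      (∀ f ∈ F, ∀ w ∈ ρ f • U, ρ y⁻¹ w = c⁻¹ • w) → ∀ x ∈ K, y * x * y⁻¹ ∈ K := by
    intro y c hc0 hy hy' x hx f hf w hw
    rw [map_mul, map_mul]
    change ρ y (ρ x (ρ y⁻¹ w)) = w
    rw [hy' f hf w hw, map_smul, hx f hf w hw, map_smul, hy f hf w hw, inv_smul_smul₀ hc0]
  have hyJ : y ∈ J := by
    refine Subgroup.mem_normalizer_iff.2 fun x => ⟨hconj hc0 hy hyinv x, fun h => ?_⟩
    have := hconj (inv_ne_zero hc0) hyinv (by simpa using hy) _ h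
    rwa [show y⁻¹ * (y * x * y⁻¹) * y⁻¹⁻¹ = x by group] at this
  have hcomm : ∀ f ∈ F, y * f * y⁻¹ * f⁻¹ ∈ K := by
    intro g hg f hf w hw
    have h1 : ρ g⁻¹ w ∈ ρ (g⁻¹ * f) • U := by rw [map_mul, mul_smul]; exact hmv hw
    rw [map_mul, map_mul, map_mul]
    change ρ y (ρ g (ρ y⁻¹ (ρ g⁻¹ w))) = w
    rw [hyinv _ (F.mul_mem (F.inv_mem hg) hf) _ h1, map_smul, map_smul, map_inv]
    change c⁻¹ • ρ y (ρ g ((ρ g).symm w)) = w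
    rw [LinearEquiv.apply_symm_apply, hy f hf w hw, inv_smul_smul₀ hc0]
  have hKJ : (K.subgroupOf J).Normal := Subgroup.normal_in_normalizer
  -- Inside J = N_G(K), y normalizes FK and therefore lies in it; so the scalar c is already
  -- realized by an element f of F.
  have hmem := (hF.toIsCarter.subgroupOf hFJ).mem_sup_of_conj (N := K.subgroupOf J)
    (g := ⟨y, hyJ⟩) (by
      intro x hx
      obtain ⟨f, hf, n, hn, rfl⟩ := Subgroup.mem_sup_of_normal_right.1 hx
      have h1 : (⟨y, hyJ⟩ : J) * (f * n) * (⟨y, hyJ⟩ : J)⁻¹ =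
          (⟨y, hyJ⟩ * f * (⟨y, hyJ⟩ : J)⁻¹ * f⁻¹) * f * (⟨y, hyJ⟩ * n * (⟨y, hyJ⟩ : J)⁻¹) := by
        group
      rw [h1]
      refine mul_mem (mul_mem ?_ (Subgroup.mem_sup_left hf))
        (Subgroup.mem_sup_right (hKJ.conj_mem n hn _))
      exact Subgroup.mem_sup_right (Subgroup.mem_subgroupOf.2
        (hcomm f (Subgroup.mem_subgroupOf.1 hf))))
  obtain ⟨f, hf, n, hn, hfn⟩ := Subgroup.mem_sup_of_normal_right.1 hmem
  have hf' : (f : G) ∈ F := Subgroup.mem_subgroupOf.1 hf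
  have hn' : (n : G) ∈ K := Subgroup.mem_subgroupOf.1 hn
  have hyfn : (f : G) * n = y := congrArg Subtype.val hfn
  have hfc : ∀ g ∈ F, ∀ w ∈ ρ g • U, ρ f w = c • w := by
    intro g hg w hw
    have h1 := hy g hg w hw
    rw [← hyfn, map_mul] at h1
    change ρ f (ρ n w) = _ at h1
    rwa [hn' g hg w hw] at h1
  have hσU' : ∀ g ∈ F, ∀ w ∈ ρ g • U, σ h₁⁻¹ w ∈ ρ (α h₁⁻¹ g) • U := by
    intro g _ w hw
    have := hmv (g := σ h₁⁻¹) hw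
    have h5 : σ h₁⁻¹ • U = U := by rw [map_inv, inv_smul_eq_iff, hU]
    rwa [hsw, h5] at this
  have hσρ : ∀ g w, ρ (α h₁ g) w = σ h₁ (ρ g (σ h₁⁻¹ w)) := by
    intro g w
    have := congrArg (fun t : W ≃ₗ[k] W => t (σ h₁⁻¹ w)) (hρσ h₁ g)
    change σ h₁ (ρ g (σ h₁⁻¹ w)) = ρ (α h₁ g) (σ h₁ (σ h₁⁻¹ w)) at this
    rw [this, map_inv]
    exact congrArg _ (LinearEquiv.apply_symm_apply (σ h₁) w).symm
  have hσσ : ∀ w, σ h₁ (σ h₁⁻¹ w) = w := by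
    intro w
    rw [map_inv]
    exact LinearEquiv.apply_symm_apply (σ h₁) w
  -- As h₁ permutes the translates of U, its image of f acts on them as the same scalar c. Hence
  -- f⁻¹h₁(f) ∈ K, and fixed-point-freeness of h₁ on F gives f ∈ K.
  have hfK : (f : G) ∈ K := by
    refine mem_of_inv_mul_apply_mem (α h₁).toMonoidHom F K (hF.invariant h₁) ?_
      (hF.eq_one_of_fixed h₁ hh₁) hf' ?_
    · intro x hx g hg w hw
      change ρ (α h₁ x) w = w
      rw [hσρ, hx _ (hF.invariant _ _ hg) _ (hσU' g hg w hw), hσσ]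
    · intro g hg w hw
      rw [map_mul]
      change ρ (f : G)⁻¹ (ρ (α h₁ f) w) = w
      rw [hσρ, hfc _ (hF.invariant _ _ hg) _ (hσU' g hg w hw), map_smul, hσσ, ← hfc g hg w hw,
        map_inv]
      exact LinearEquiv.symm_apply_apply (ρ f) w
  obtain ⟨w, hw, hw0⟩ := Submodule.exists_mem_ne_zero_of_ne_bot hU0
  have hw1 : w ∈ ρ 1 • U := by simpa using hw
  have h1 := hfc 1 F.one_mem w hw1
  rw [hfK 1 F.one_mem w hw1] at h1
  have h2 : (c - 1) • w = 0 := by rw [sub_smul, one_smul, ← h1, sub_self]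
  rcases smul_eq_zero.1 h2 with h3 | h3
  · exact sub_eq_zero.1 h3
  · exact absurd h3 hw0

end

/-- If an `H`-fixed element `x`, generating together with its `F`-conjugates a `q`-group of linear
automorphisms in characteristic different from `q`, acts trivially on the image of the trace map of
`H`, then it acts trivially. -/
theorem IsFrobeniusCarter.apply_eq_one_of_trace {k W G H : Type*} [Field k] [IsAlgClosed k]
    [AddCommGroup W] [Module k W] [FiniteDimensional k W] [Group G] [Finite G] [Group.IsSolvable G]
    [Group H] [Fintype H] {α : H →* MulAut G} {F : Subgroup G} (hF : IsFrobeniusCarter α F)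
    (ρ : G →* (W ≃ₗ[k] W)) (σ : H →* (W ≃ₗ[k] W)) (hρσ : ∀ h g, σ h * ρ g = ρ (α h g) * σ h)
    {q : ℕ} [Fact q.Prime] (hqk : (q : k) ≠ 0) {x : G} (hx : x ∈ fixedSubgroup α)
    {Q : Subgroup (W ≃ₗ[k] W)} [Finite Q]
    (hQ : Q = Subgroup.closure ((fun f => ρ (f * x * f⁻¹)) '' (F : Set G))) (hQq : IsPGroup q Q)
    (htr : ∀ w, ρ x (∑ h, σ h w) = ∑ h, σ h w) : ρ x = 1 := by
  classical
  by_contra hx1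
  have hmv : ∀ {V : Submodule k W} {g : W ≃ₗ[k] W} {w : W}, w ∈ V → g w ∈ g • V :=
    fun {V g w} hw => Submodule.smul_mem_pointwise_smul w g V hw
  have hinv_apply : ∀ (g : W ≃ₗ[k] W) w, g⁻¹ (g w) = w := fun g w => g.symm_apply_apply w
  have happly_inv : ∀ (g : W ≃ₗ[k] W) w, g (g⁻¹ w) = w := fun g w => g.apply_symm_apply w
  have hgen : ∀ f ∈ F, ρ (f * x * f⁻¹) ∈ Q := fun f hf => by
    rw [hQ]; exact Subgroup.subset_closure ⟨f, hf, rfl⟩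
  have hxQ : ρ x ∈ Q := by simpa using hgen 1 F.one_mem
  have hQρ : ∀ y ∈ Q, ∃ g, ρ g = y := by
    have : Q ≤ ρ.range := by
      rw [hQ, Subgroup.closure_le]
      rintro _ ⟨f, -, rfl⟩
      exact ⟨_, rfl⟩
    exact fun y hy => this hy
  have hconjQ : ∀ t : W ≃ₗ[k] W, (∀ f ∈ F, t * ρ (f * x * f⁻¹) * t⁻¹ ∈ Q) →
      ∀ y ∈ Q, t * y * t⁻¹ ∈ Q := by
    intro t ht y hy
    have : Q ≤ Q.comap (MulAut.conj t).toMonoidHom := by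
      conv_lhs => rw [hQ]
      rw [Subgroup.closure_le]
      rintro _ ⟨f, hf, rfl⟩
      exact ht f hf
    exact this hy
  have hQF : ∀ f ∈ F, ∀ y ∈ Q, ρ f * y * (ρ f)⁻¹ ∈ Q := fun f hf => hconjQ _ fun g hg => by
    have := hgen (f * g) (F.mul_mem hf hg)
    rwa [show f * g * x * (f * g)⁻¹ = f * (g * x * g⁻¹) * f⁻¹ by group, map_mul, map_mul,
      map_inv] at this
  have hQH : ∀ h, ∀ y ∈ Q, σ h * y * (σ h)⁻¹ ∈ Q := fun h => hconjQ _ fun g hg => by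
    have h1 : α h (g * x * g⁻¹) = α h g * x * (α h g)⁻¹ := by
      rw [map_mul, map_mul, map_inv, hx h]
    rw [hρσ, mul_inv_cancel_right, h1]
    exact hgen _ (hF.invariant h g hg)
  -- the center of `Q`
  have hnt : Nontrivial Q := ⟨⟨⟨ρ x, hxQ⟩, 1, fun h => hx1 (congrArg Subtype.val h)⟩⟩
  have hcn := hQq.center_nontrivial
  let A : Subgroup (W ≃ₗ[k] W) := (Subgroup.center Q).map Q.subtype
  have hA : ∀ a, a ∈ A ↔ a ∈ Q ∧ ∀ y ∈ Q, y * a = a * y := by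
    intro a
    constructor
    · rintro ⟨a, ha, rfl⟩
      exact ⟨a.2, fun y hy => congrArg Subtype.val (Subgroup.mem_center_iff.1 ha ⟨y, hy⟩)⟩
    · rintro ⟨ha, ha'⟩
      exact ⟨⟨a, ha⟩, Subgroup.mem_center_iff.2 fun y => Subtype.ext (ha' y y.2), rfl⟩
  have hconjA : ∀ t : W ≃ₗ[k] W, (∀ y ∈ Q, t * y * t⁻¹ ∈ Q) → (∀ y ∈ Q, t⁻¹ * y * t ∈ Q) →
      ∀ a ∈ A, t * a * t⁻¹ ∈ A := by
    intro t ht ht' a ha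
    rw [hA] at ha ⊢
    refine ⟨ht a ha.1, fun y hy => ?_⟩
    have := ha.2 _ (ht' y hy)
    calc y * (t * a * t⁻¹) = t * (t⁻¹ * y * t * a) * t⁻¹ := by group
      _ = t * a * t⁻¹ * y := by rw [this]; group
  have hQF' : ∀ f ∈ F, ∀ y ∈ Q, (ρ f)⁻¹ * y * ρ f ∈ Q := fun f hf y hy => by
    simpa using hQF f⁻¹ (F.inv_mem hf) y hy
  have hQH' : ∀ h, ∀ y ∈ Q, (σ h)⁻¹ * y * σ h ∈ Q := fun h y hy => by
    simpa using hQH h⁻¹ y hy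
  have hAF : ∀ f ∈ F, ∀ a ∈ A, ρ f * a * (ρ f)⁻¹ ∈ A := fun f hf => hconjA _ (hQF f hf) (hQF' f hf)
  have hAF' : ∀ f ∈ F, ∀ a ∈ A, (ρ f)⁻¹ * a * ρ f ∈ A := fun f hf a ha => by
    simpa using hAF f⁻¹ (F.inv_mem hf) a ha
  have hAH : ∀ h, ∀ a ∈ A, σ h * a * (σ h)⁻¹ ∈ A := fun h => hconjA _ (hQH h) (hQH' h)
  have hAH' : ∀ h, ∀ a ∈ A, (σ h)⁻¹ * a * σ h ∈ A := fun h a ha => by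
    simpa using hAH h⁻¹ a ha
  obtain ⟨S, hStop, hSind, hSbot, hSscal, hSconj, hScomm⟩ := exists_weightSpaces A
    (fun a ha b hb => ((hA b).1 hb).2 a ((hA a).1 ha).1) (fun a ha => by
      obtain ⟨n, hn⟩ := isPGroup_iff_pow_pow_eq_one.1 hQq ⟨a, ((hA a).1 ha).1⟩
      refine ⟨q ^ n, congrArg Subtype.val hn, ?_⟩
      rw [Nat.cast_pow]
      exact pow_ne_zero n hqk)
  have hSF : ∀ f ∈ F, ∀ U ∈ S, ρ f • U ∈ S := fun f hf => hSconj _ (hAF f hf) (hAF' f hf)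
  have hSH : ∀ h, ∀ U ∈ S, σ h • U ∈ S := fun h => hSconj _ (hAH h) (hAH' h)
  have hSQ : ∀ y ∈ Q, ∀ U ∈ S, ∀ w ∈ U, y w ∈ U := fun y hy =>
    hScomm y fun a ha => ((hA a).1 ha).2 y hy
  have hxreg : ∀ U ∈ S, (∀ h, σ h • U = U → h = 1) → ∀ w ∈ U, ρ x w = w := fun U hU hst w hw =>
    apply_eq_self_of_stabilizer_eq_one σ hSind (fun h => hSH h U hU) hst
      (fun h => by rw [hρσ, hx h]) (hSQ _ hxQ U hU) htr hw
  -- a weight space on which `x` and some central element act nontrivially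
  obtain ⟨U, hUS, a, haA, haU, hxU⟩ : ∃ U ∈ S, ∃ a ∈ A, (∃ w ∈ U, a w ≠ w) ∧
      ∃ w ∈ U, ρ x w ≠ w := by
    obtain ⟨a, ha1⟩ := exists_ne (1 : Subgroup.center Q)
    have haA : ((a : Q) : W ≃ₗ[k] W) ∈ A := ⟨a, a.2, rfl⟩
    obtain ⟨U, hU, w, hw, haw⟩ : ∃ U ∈ S, ∃ w ∈ U, ((a : Q) : W ≃ₗ[k] W) w ≠ w := by
      by_contra! hcon
      refine ha1 (Subtype.ext (Subtype.ext (LinearEquiv.ext fun w => ?_)))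
      have : (⊤ : Submodule k W) ≤ LinearMap.eqLocus ((a : Q) : W ≃ₗ[k] W).toLinearMap
          LinearMap.id := by
        rw [← hStop]
        exact sSup_le fun U hU w hw => hcon U hU w hw
      exact this (Submodule.mem_top (x := w))
    -- If every F-conjugate of x acted trivially on U, so would Q and with it a. Replacing U by f⁻¹U
    -- turns the conjugate by f into x itself.
    obtain ⟨f, hf, v, hv, hfv⟩ : ∃ f ∈ F, ∃ v ∈ U, ρ (f * x * f⁻¹) v ≠ v := by
      by_contra! hcon
      refine haw ?_
      have : ∀ y ∈ Q, ∀ w ∈ U, y w = w := by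
        intro y hy
        rw [hQ] at hy
        induction hy using Subgroup.closure_induction with
        | mem y hy =>
          obtain ⟨f, hf, rfl⟩ := hy
          exact hcon f hf
        | one => exact fun w _ => rfl
        | mul y z _ _ hy hz =>
          intro w hw
          change y (z w) = w
          rw [hz w hw, hy w hw]
        | inv y _ hy =>
          intro w hw
          conv_lhs => rw [← hy w hw]
          exact hinv_apply y w
      exact this _ ((hA _).1 haA).1 w hw
    refine ⟨ρ f⁻¹ • U, hSF _ (F.inv_mem hf) U hU, (ρ f)⁻¹ * (a : Q) * ρ f, hAF' f hf _ haA,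
      ⟨ρ f⁻¹ w, hmv hw, fun h => haw ?_⟩, ρ f⁻¹ v, hmv hv, fun h => hfv ?_⟩
    · rw [map_inv] at h
      change (ρ f)⁻¹ (((a : Q) : W ≃ₗ[k] W) (ρ f ((ρ f)⁻¹ w))) = (ρ f)⁻¹ w at h
      rw [happly_inv] at h
      exact (ρ f)⁻¹.injective h
    · rw [map_mul, map_mul]
      change ρ f (ρ x (ρ f⁻¹ v)) = v
      rw [h, map_inv, happly_inv]
  obtain ⟨c, hc⟩ := hSscal U hUS a haA
  have hU0 : U ≠ ⊥ := fun h => hSbot (h ▸ hUS)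
  obtain ⟨h₁, hh₁U, hh₁⟩ : ∃ h, σ h • U = U ∧ h ≠ 1 := by
    by_contra! hcon
    obtain ⟨w, hw, hxw⟩ := hxU
    exact hxw (hxreg U hUS hcon w hw)
  have hxother : ∀ f ∈ F, ρ f • U ≠ U → ∀ w ∈ ρ f • U, ρ x w = w := fun f hf hfU =>
    hxreg _ (hSF f hf U hUS) fun h hh =>
      hF.stabilizer_eq_one_of_smul_ne ρ σ hρσ hh₁ hh₁U hf hfU hh
  -- elements of `Q` can be made trivial on the other translates of `U`
  have hcut : ∀ y ∈ Q, ∃ b ∈ Q, (∀ w ∈ U, b w = y w) ∧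
      ∀ f ∈ F, ρ f • U ≠ U → ∀ w ∈ ρ f • U, b w = w := by
    intro y hy
    rw [hQ] at hy
    induction hy using Subgroup.closure_induction with
    | mem y hy =>
      obtain ⟨f, hf, rfl⟩ := hy
      have hfm : ∀ g w, w ∈ ρ g • U → ρ f⁻¹ w ∈ ρ (f⁻¹ * g) • U := fun g w hw => by
        rw [map_mul, mul_smul]; exact hmv hw
      have hfx : ∀ g ∈ F, ρ (f⁻¹ * g) • U ≠ U → ∀ w ∈ ρ g • U, ρ (f * x * f⁻¹) w = w := by
        intro g hg hgU w hw
        rw [map_mul, map_mul]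
        change ρ f (ρ x (ρ f⁻¹ w)) = w
        rw [hxother _ (F.mul_mem (F.inv_mem hf) hg) hgU _ (hfm g w hw), map_inv, happly_inv]
      -- The generator fxf⁻¹ can act nontrivially only on the translate fU. It is kept if fU = U;
      -- otherwise it is trivial on U and 1 replaces it.
      by_cases hfU : ρ f⁻¹ • U = U
      · refine ⟨_, hgen f hf, fun w _ => rfl, fun g hg hgU => hfx g hg fun h => hgU ?_⟩
        rw [map_mul, mul_smul, map_inv, inv_smul_eq_iff] at h
        rw [map_inv, inv_smul_eq_iff] at hfU
        rw [h, ← hfU]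
      · refine ⟨1, Q.one_mem, fun w hw => (hfx 1 F.one_mem ?_ w ?_).symm, fun g _ _ w _ => rfl⟩
        · rwa [mul_one]
        · simpa using hw
    | one => exact ⟨1, Q.one_mem, fun _ _ => rfl, fun _ _ _ _ _ => rfl⟩
    | mul y z hyQ hzQ hy hz =>
      obtain ⟨b, hb, hb1, hb2⟩ := hy
      obtain ⟨b', hb', hb1', hb2'⟩ := hz
      refine ⟨b * b', Q.mul_mem hb hb', fun w hw => ?_, fun f hf hfU w hw => ?_⟩
      · change b (b' w) = y (z w)
        rw [hb1' w hw, hb1 _ (hSQ z (by rwa [hQ]) U hUS w hw)]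
      · change b (b' w) = w
        rw [hb2' f hf hfU w hw, hb2 f hf hfU w hw]
    | inv y hyQ hy =>
      obtain ⟨b, hb, hb1, hb2⟩ := hy
      refine ⟨b⁻¹, Q.inv_mem hb, fun w hw => ?_, fun f hf hfU w hw => ?_⟩
      · have h1 := hb1 _ (hSQ y⁻¹ (Q.inv_mem (by rwa [hQ])) U hUS w hw)
        rw [happly_inv] at h1
        conv_lhs => rw [← h1]
        rw [hinv_apply]
      · conv_lhs => rw [← hb2 f hf hfU w hw]
        rw [hinv_apply]
  obtain ⟨b, hbQ, hbU, hbother⟩ := hcut a ((hA a).1 haA).1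
  -- Multiplying F-conjugates of b, one for each distinct translate in s, gives an element of Q
  -- acting as c on the translates in s and trivially on the others. With all translates in s it is
  -- a scalar on their sum, which `scalar_eq_one` forbids unless c = 1.
  have hprod : ∀ s : Finset (Submodule k W), ∃ z ∈ Q, ∀ f ∈ F, ∀ w ∈ ρ f • U,
      z w = if ρ f • U ∈ s then c • w else w := by
    intro s
    induction s using Finset.induction_on with
    | empty => exact ⟨1, Q.one_mem, fun f _ w _ => by simp⟩
    | insert V s hVs ih =>
      obtain ⟨z, hz, hzw⟩ := ih
      by_cases hV : ∃ g ∈ F, ρ g • U = V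
      · obtain ⟨g, hg, rfl⟩ := hV
        refine ⟨ρ g * b * (ρ g)⁻¹ * z, Q.mul_mem (hQF g hg b hbQ) hz, fun f hf w hw => ?_⟩
        change ρ g (b ((ρ g)⁻¹ (z w))) = _
        by_cases hfg : ρ f • U = ρ g • U
        · have h1 : (ρ g)⁻¹ w ∈ U := by
            rw [hfg] at hw
            exact LinearEquiv.mem_smul_submodule_iff.1 hw
          rw [hzw f hf w hw, hfg, if_neg hVs, if_pos (Finset.mem_insert_self _ _), hbU _ h1,
            hc _ h1, map_smul, happly_inv]
        · have h1 : ρ (g⁻¹ * f) • U ≠ U := by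
            intro h
            rw [map_mul, mul_smul, map_inv, inv_smul_eq_iff] at h
            exact hfg h
          have h2 : (ρ g)⁻¹ (z w) ∈ ρ (g⁻¹ * f) • U := by
            rw [map_mul, mul_smul, map_inv]
            exact hmv (hSQ z hz _ (hSF f hf U hUS) w hw)
          rw [hbother _ (F.mul_mem (F.inv_mem hg) hf) h1 _ h2, happly_inv, hzw f hf w hw]
          simp only [Finset.mem_insert, hfg, false_or]
      · refine ⟨z, hz, fun f hf w hw => ?_⟩
        have h1 : ρ f • U ≠ V := fun h => hV ⟨f, hf, h⟩
        rw [hzw f hf w hw]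
        simp only [Finset.mem_insert, h1, false_or]
  have : Fintype G := Fintype.ofFinite G
  obtain ⟨z, hz, hzw⟩ := hprod (Finset.univ.image fun f => ρ f • U)
  obtain ⟨y, rfl⟩ := hQρ z hz
  have hc1 : c = 1 := hF.scalar_eq_one ρ σ hρσ hU0 hh₁ hh₁U (y := y) fun f hf w hw => by
    rw [hzw f hf w hw, if_pos (Finset.mem_image_of_mem _ (Finset.mem_univ f))]
  obtain ⟨w, hw, haw⟩ := haU
  exact haw (by rw [hc w hw, hc1, one_smul])

/-! ### Normal q-subgroups of the group of fixed points -/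

/-- Extension of scalars, as a homomorphism between general linear groups. -/
noncomputable def LinearEquiv.baseChangeHom (R A M : Type*) [CommSemiring R] [Semiring A]
    [Algebra R A] [AddCommMonoid M] [Module R M] :
    (M ≃ₗ[R] M) →* ((A ⊗[R] M) ≃ₗ[A] (A ⊗[R] M)) where
  toFun e := e.baseChange R A M M
  map_one' := LinearEquiv.baseChange_one R A M
  map_mul' e f := LinearEquiv.baseChange_mul R A M e f

/-- Automorphisms of a commutative group of prime exponent `p` as linear automorphisms over
`ZMod p`. -/
def MulAut.toZModLinearEquiv (p : ℕ) (V : Type*) [CommGroup V] [Module (ZMod p) (Additive V)] :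
    MulAut V →* (Additive V ≃ₗ[ZMod p] Additive V) where
  toFun φ := (MulEquiv.toAdditive φ).toLinearEquiv
    (fun c x => ZMod.map_smul (MulEquiv.toAdditive φ).toAddMonoidHom c x)
  map_one' := rfl
  map_mul' _ _ := rfl

/-- Extending scalars makes weight spaces available. The trace of c ⊗ a is c ⊗ (product of the
H-images of a), and this product is H-fixed, so `hxA` supplies the trace hypothesis; injectivity of
a ↦ 1 ⊗ a brings the conclusion back. -/
theorem IsFrobeniusCarter.mulAut_apply_eq_one_of_isAlgClosed {G H : Type*} [Group G] [Finite G]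
    [Group.IsSolvable G] [Group H] [Finite H] {α : H →* MulAut G} {F : Subgroup G}
    (hF : IsFrobeniusCarter α F) {p q : ℕ} [hp : Fact p.Prime] [hq : Fact q.Prime] (hpq : p ≠ q)
    (k : Type*) [Field k] [Algebra (ZMod p) k] [IsAlgClosed k] {A : Type*} [CommGroup A] [Finite A] [Module (ZMod p) (Additive A)]
    (ρ : G →* MulAut A)
    (σ : H →* MulAut A) (hσρ : ∀ h g a, σ h (ρ g a) = ρ (α h g) (σ h a))
    {R : Subgroup G} [hRn : R.Normal] (hR : ∀ r ∈ R, ∃ n, ρ (r ^ q ^ n) = 1) {x : G} (hxR : x ∈ R)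
    (hx : x ∈ fixedSubgroup α) (hxA : ∀ a, (∀ h, σ h a = a) → ρ x a = a) : ρ x = 1 := by
  classical
  have : Fintype H := Fintype.ofFinite H
  let e : MulAut A →* (Additive A ≃ₗ[ZMod p] Additive A) := MulAut.toZModLinearEquiv p A
  let bc₀ := LinearEquiv.baseChangeHom (ZMod p) k (Additive A)
  let bc := bc₀.comp e
  have hbc : ∀ e (c : k) (a : A), bc e (c ⊗ₜ Additive.ofMul a) = c ⊗ₜ Additive.ofMul (e a) :=
    fun _ _ _ => rfl
  have hfin : Module.Finite (ZMod p) (Additive A) := Module.Finite.of_finite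
  have hqk : (q : k) ≠ 0 := by
    intro h
    have := ZMod.charP p
    have := charP_of_injective_algebraMap (algebraMap (ZMod p) k).injective p
    have hd : p ∣ q := (CharP.cast_eq_zero_iff k p q).1 h
    exact hpq ((Nat.prime_dvd_prime_iff_eq hp.out hq.out).1 hd)
  have hmap : Subgroup.closure ((fun f => (bc.comp ρ) (f * x * f⁻¹)) '' (F : Set G)) ≤
      R.map (bc.comp ρ) := by
    rw [Subgroup.closure_le]
    rintro _ ⟨f, -, rfl⟩
    exact ⟨_, hRn.conj_mem x hxR f, rfl⟩
  have hRq : IsPGroup q (R.map (bc.comp ρ)) := by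
    rw [isPGroup_iff_pow_pow_eq_one]
    rintro ⟨_, r, hr, rfl⟩
    obtain ⟨n, hn⟩ := hR r hr
    refine ⟨n, Subtype.ext ?_⟩
    change (bc.comp ρ) r ^ q ^ n = 1
    rw [← map_pow, MonoidHom.comp_apply, hn, map_one]
  have : Finite (R.map (bc.comp ρ)) :=
    Finite.of_surjective _ ((bc.comp ρ).subgroupMap_surjective R)
  have : Finite (Subgroup.closure ((fun f => (bc.comp ρ) (f * x * f⁻¹)) '' (F : Set G))) :=
    Finite.of_injective _ (Subgroup.inclusion_injective hmap)
  have hmain := hF.apply_eq_one_of_trace (bc.comp ρ) (bc.comp σ)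
    (fun h g => by
      simp only [MonoidHom.comp_apply, ← map_mul]
      congr 1
      exact MulEquiv.ext fun a => hσρ h g a)
    hqk hx rfl (hRq.to_le hmap)
    (by
      intro w
      induction w using TensorProduct.induction_on with
      | zero => simp
      | add a b ha hb => simp only [map_add, Finset.sum_add_distrib, ha, hb]
      | tmul c m =>
        obtain ⟨a, rfl⟩ := Additive.ofMul.surjective m
        simp only [MonoidHom.comp_apply, hbc, ← TensorProduct.tmul_sum, ← ofMul_prod]
        congr 2
        refine hxA _ fun s => ?_
        rw [map_prod]
        refine Fintype.prod_equiv (Equiv.mulLeft s) _ _ fun h => ?_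
        rw [Equiv.coe_mulLeft, map_mul, MulAut.mul_apply])
  refine MulEquiv.ext fun a => ?_
  have h1 : bc (ρ x) ((1 : k) ⊗ₜ Additive.ofMul a) = (1 : k) ⊗ₜ Additive.ofMul a := by
    rw [← MonoidHom.comp_apply, hmain]
    rfl
  rw [hbc] at h1
  exact Module.FaithfullyFlat.tensorProduct_mk_injective (A := ZMod p) (B := k) (Additive A) h1

/-- This is the linear result for conjugation on V: R acts as a q-group because V, being abelian,
acts trivially on itself. -/
theorem IsFrobeniusCarter.commute_of_commute_fixed {G H : Type*} [Group G] [Finite G]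
    [Group.IsSolvable G] [Group H] [Finite H] {α : H →* MulAut G} {F : Subgroup G}
    (hF : IsFrobeniusCarter α F) {p q : ℕ} [hp : Fact p.Prime] [hq : Fact q.Prime] (hpq : p ≠ q)
    {V : Subgroup G} [hVn : V.Normal] (hcomm : ∀ a ∈ V, ∀ b ∈ V, a * b = b * a)
    (hpow : ∀ v ∈ V, v ^ p = 1) (hVα : ∀ h, ∀ v ∈ V, α h v ∈ V) {R : Subgroup G} [hRn : R.Normal]
    (hR : ∀ r ∈ R, ∃ n, r ^ q ^ n ∈ V) {x : G} (hxR : x ∈ R) (hx : x ∈ fixedSubgroup α)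
    (hxV : ∀ v ∈ V, v ∈ fixedSubgroup α → x * v = v * x) {v : G} (hv : v ∈ V) :
    x * v = v * x := by
  let _ : CommGroup V := { (inferInstance : Group V) with
    mul_comm := fun a b => Subtype.ext (hcomm a a.2 b b.2) }
  let _ : Module (ZMod p) (Additive V) := AddCommGroup.zmodModule fun m =>
    congrArg Additive.ofMul (Subtype.ext (hpow m.toMul m.toMul.2) : m.toMul ^ p = 1)
  have h := hF.mulAut_apply_eq_one_of_isAlgClosed hpq (AlgebraicClosure (ZMod p)) (A := V)
    MulAut.conjNormal (restrictAut α V hVα) (fun h g a => Subtype.ext (by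
      change α h (MulAut.conjNormal g a : V) =
        (MulAut.conjNormal (α h g) (restrictAut α V hVα h a) : V)
      simp [MulAut.conjNormal_apply])) (R := R) (fun r hr => ?_) hxR hx (fun a ha => ?_)
  · have h4 : x * v * x⁻¹ = v :=
      (MulAut.conjNormal_apply x (⟨v, hv⟩ : V)).symm.trans
        (congrArg Subtype.val (DFunLike.congr_fun h (⟨v, hv⟩ : V)))
    exact mul_inv_eq_iff_eq_mul.1 h4
  · obtain ⟨n, hn⟩ := hR r hr
    refine ⟨n, MulEquiv.ext fun a => Subtype.ext ?_⟩
    refine (MulAut.conjNormal_apply _ a).trans ?_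
    rw [mul_inv_eq_iff_eq_mul]
    exact hcomm _ hn _ a.2
  · refine Subtype.ext ((MulAut.conjNormal_apply _ a).trans ?_)
    rw [mul_inv_eq_iff_eq_mul]
    exact hxV _ a.2 fun h => congrArg Subtype.val (ha h)

/-- The normal closure of a normal `q`-subgroup of the fixed points is a `q`-group. -/
theorem IsFrobeniusCarter.isPGroup_normalClosure {G H : Type*} [Group G] [Finite G]
    [Group.IsSolvable G] [Group H] [Finite H] {α : H →* MulAut G} {F : Subgroup G}
    (hF : IsFrobeniusCarter α F) {q : ℕ} [hq : Fact q.Prime] {X : Subgroup G}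
    (hXα : X ≤ fixedSubgroup α) (hXn : ∀ c ∈ fixedSubgroup α, ∀ x ∈ X, c * x * c⁻¹ ∈ X)
    (hX : IsPGroup q X) : IsPGroup q (Subgroup.normalClosure (X : Set G)) := by
  induction hn : Nat.card G using Nat.strong_induction_on generalizing G with
  | _ n ih =>
  by_cases hG : (⊤ : Subgroup G) = ⊥
  · exact IsPGroup.of_bot.to_le (le_top.trans hG.le)
  obtain ⟨p, hp, V, -, hV0, hc, hpow, hchar⟩ := exists_elementaryAbelian_le ⊤ hG
  have := Fact.mk hp
  have hVn : V.Normal := ⟨fun v hv x => hchar (MulAut.conj x) (fun _ _ => trivial) v hv⟩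
  have hVα : ∀ h, ∀ v ∈ V, α h v ∈ V := fun h => hchar (α h) (fun _ _ => trivial)
  have hX' := ih _ (by rw [← hn]; exact Nat.card_quotient_lt hV0) (hF.map_mk V hVα)
    (X := X.map (QuotientGroup.mk' V))
    (by
      rintro _ ⟨x, hx, rfl⟩ h
      exact congrArg _ (hXα hx h))
    (by
      rintro ⟨c⟩ hc _ ⟨x, hx, rfl⟩
      obtain ⟨v, hv, hcv⟩ := hF.exists_mul_mem_fixed hVα (g := c)
        (fun h => QuotientGroup.eq.1 (hc h).symm)
      refine ⟨c * v * x * (c * v)⁻¹, hXn _ hcv x hx, ?_⟩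
      have h1 : ((c * v : G) : G ⧸ V) = c := by
        rw [QuotientGroup.mk_mul, (QuotientGroup.eq_one_iff v).2 hv, mul_one]
      change ((c * v * x * (c * v)⁻¹ : G) : G ⧸ V) = (c : G ⧸ V) * (x : G ⧸ V) * (c : G ⧸ V)⁻¹
      rw [QuotientGroup.mk_mul, QuotientGroup.mk_mul, QuotientGroup.mk_inv, h1])
    (hX.map _) rfl
  let Y : Subgroup (G ⧸ V) :=
    Subgroup.normalClosure ((X.map (QuotientGroup.mk' V) : Subgroup (G ⧸ V)) : Set (G ⧸ V))
  let R : Subgroup G := Y.comap (QuotientGroup.mk' V)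
  have hXR : X ≤ R := fun x hx => Subgroup.subset_normalClosure ⟨x, hx, rfl⟩
  have hRn : R.Normal := inferInstance
  have hR : ∀ r ∈ R, ∃ m, r ^ q ^ m ∈ V := by
    intro r hr
    obtain ⟨m, hm⟩ := isPGroup_iff_pow_pow_eq_one.1 hX' ⟨_, hr⟩
    refine ⟨m, (QuotientGroup.eq_one_iff _).1 ?_⟩
    exact congrArg Subtype.val hm
  by_cases hpq : p = q
  · subst hpq
    have : IsPGroup p R := by
      rw [isPGroup_iff_pow_pow_eq_one]
      intro r
      obtain ⟨m, hm⟩ := hR r r.2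
      refine ⟨m + 1, Subtype.ext ?_⟩
      rw [pow_succ, pow_mul]
      exact hpow _ hm
    exact this.to_le (Subgroup.normalClosure_le_normal hXR)
  -- As X is normal in the fixed points, [X, C_V(H)] ≤ X ∩ V = 1, so X centralizes C_V(H) and hence
  -- V.
  · have hXV : X ≤ Subgroup.centralizer (V : Set G) := by
      intro x hx
      refine Subgroup.mem_centralizer_iff.2 fun v hv => ?_
      refine (hF.commute_of_commute_fixed hpq hc hpow hVα hR (hXR hx) (hXα hx) ?_ hv).symm
      intro c hcV hcα
      have h1 : x * c * x⁻¹ * c⁻¹ ∈ X := by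
        have := X.mul_mem hx (hXn c hcα x⁻¹ (X.inv_mem hx))
        rwa [show x * (c * x⁻¹ * c⁻¹) = x * c * x⁻¹ * c⁻¹ by group] at this
      have h2 : x * c * x⁻¹ * c⁻¹ ∈ V := V.mul_mem (hVn.conj_mem c hcV x) (V.inv_mem hcV)
      have h3 := Subgroup.disjoint_def.1 (IsPGroup.disjoint_of_ne p q hpq V X
        (IsPGroup.of_pow_eq_one hpow) hX) h2 h1
      exact mul_inv_eq_iff_eq_mul.1 (mul_inv_eq_one.1 h3)
    -- C_R(V) is a central extension of a subgroup of the q-group Y, so it is nilpotent; its Sylow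
    -- q-subgroup is normal in G and contains X.
    let R₁ : Subgroup G := R ⊓ Subgroup.centralizer (V : Set G)
    have hR₁n : R₁.Normal := inferInstance
    have hYq : Group.IsNilpotent Y := hX'.isNilpotent
    let f : R₁ →* Y := ((QuotientGroup.mk' V).comp R₁.subtype).codRestrict Y fun r => r.2.1
    have hnil : Group.IsNilpotent R₁ := by
      refine Subgroup.isNilpotent_of_ker_le_center f fun r hr => ?_
      have hrV : (r : G) ∈ V := (QuotientGroup.eq_one_iff _).1 (congrArg Subtype.val hr)
      refine Subgroup.mem_center_iff.2 fun s => Subtype.ext ?_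
      exact (Subgroup.mem_centralizer_iff.1 s.2.2 r hrV).symm
    let P : Sylow q R₁ := default
    have hPn : (P : Subgroup R₁).Normal := inferInstance
    have hPc : (P : Subgroup R₁).Characteristic := Sylow.characteristic_of_normal P hPn
    have hPG : ((P : Subgroup R₁).map R₁.subtype).Normal := inferInstance
    refine (P.isPGroup'.map R₁.subtype).to_le (Subgroup.normalClosure_le_normal fun x hx => ?_)
    obtain ⟨m, hm⟩ := isPGroup_iff_pow_pow_eq_one.1 hX ⟨x, hx⟩
    exact ⟨⟨x, hXR hx, hXV hx⟩, P.mem_of_normal_of_pow_eq_one hPn (k := m)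
      (Subtype.ext (congrArg Subtype.val hm : x ^ q ^ m = 1)), rfl⟩

/-! ### Fitting subgroup and Fitting series -/

/-- A subgroup containing the elements of prime power order of a cyclic group of finite order
contains its generator. -/
theorem Subgroup.mem_of_forall_pow_prime_pow_eq_one {G : Type*} [Group G] (T : Subgroup G) {x : G}
    (hx : IsOfFinOrder x)
    (h : ∀ q : ℕ, q.Prime → ∀ k, ∀ y ∈ zpowers x, y ^ q ^ k = 1 → y ∈ T) : x ∈ T := by
  induction hn : orderOf x using Nat.strong_induction_on generalizing x with
  | _ n ih =>
  by_cases h1 : orderOf x = 1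
  · rw [orderOf_eq_one_iff.1 h1]
    exact T.one_mem
  have hq := Nat.minFac_prime h1
  have := Fact.mk hq
  obtain ⟨y, hy, z, hz, hxyz, hyq, k, hzk⟩ := exists_mul_eq_of_prime (orderOf x).minFac hx
  have hyx : orderOf y ∣ orderOf x := orderOf_dvd_of_mem_zpowers hy
  have hlt : orderOf y < orderOf x := by
    refine lt_of_le_of_ne (Nat.le_of_dvd hx.orderOf_pos hyx) fun heq => ?_
    rw [heq, Nat.coprime_comm, hq.coprime_iff_not_dvd] at hyq
    exact hyq (Nat.minFac_dvd _)
  rw [hxyz]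
  refine T.mul_mem (ih _ (hn ▸ hlt) (hx.of_mem_zpowers hy) (fun r hr m w hw => ?_) rfl)
    (h _ hq k z hz hzk)
  exact h r hr m w ((Subgroup.zpowers_le.2 hy) hw)

/-- A nilpotent normal subgroup is generated by its normal subgroups of prime power order. -/
theorem Subgroup.le_of_forall_normal_isPGroup_le {G : Type*} [Group G] [Finite G]
    {N T : Subgroup G} [N.Normal] [Group.IsNilpotent N]
    (h : ∀ (q : ℕ) [Fact q.Prime] (X : Subgroup G), X.Normal → IsPGroup q X → X ≤ T) : N ≤ T := by
  intro x hx
  refine T.mem_of_forall_pow_prime_pow_eq_one (isOfFinOrder_of_finite x) fun q hq k y hy hyk => ?_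
  have := Fact.mk hq
  have hyN : y ∈ N := (Subgroup.zpowers_le.2 hx) hy
  let P : Sylow q N := default
  have hPn : (P : Subgroup N).Normal := inferInstance
  have hPc : (P : Subgroup N).Characteristic := Sylow.characteristic_of_normal P hPn
  exact h q ((P : Subgroup N).map N.subtype) inferInstance (P.isPGroup'.map N.subtype)
    ⟨⟨y, hyN⟩, P.mem_of_normal_of_pow_eq_one hPn (k := k) (Subtype.ext hyk), rfl⟩

theorem Subgroup.Normal.le_fittingSubgroup {G : Type*} [Group G] {N : Subgroup G} (hN : N.Normal)
    (hnil : Group.IsNilpotent N) : N ≤ fittingSubgroup G :=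
  le_sSup ⟨hN, hnil⟩

/-- **Fitting's theorem** for finite groups. -/
theorem isNilpotent_fittingSubgroup (G : Type*) [Group G] [Finite G] :
    Group.IsNilpotent (fittingSubgroup G) := by
  classical
  -- O q is the largest normal q-subgroup. These subgroups commute pairwise, so their join is
  -- nilpotent, and it contains every nilpotent normal subgroup.
  let O : (Nat.card G).primeFactors → Subgroup G :=
    fun q => ((default : Sylow q G) : Subgroup G).normalCore
  have hprime : ∀ q : (Nat.card G).primeFactors, Fact (q : ℕ).Prime :=
    fun q => ⟨Nat.prime_of_mem_primeFactors q.2⟩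
  have hO : ∀ q : (Nat.card G).primeFactors, IsPGroup q (O q) := fun q =>
    (default : Sylow q G).isPGroup'.to_le (Subgroup.normalCore_le _)
  have hOn : ∀ q, Group.IsNilpotent (O q) := fun q => (hO q).isNilpotent
  have hcomm : Pairwise fun i j => ∀ x y : G, x ∈ O i → y ∈ O j → Commute x y := by
    intro i j hij
    exact Subgroup.commute_of_normal_of_disjoint _ _ inferInstance inferInstance
      (IsPGroup.disjoint_of_ne i j (fun h => hij (Subtype.ext h)) _ _ (hO i) (hO j))
  have hnil : Group.IsNilpotent (Subgroup.noncommPiCoprod hcomm).range :=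
    Group.nilpotent_of_surjective _ (Subgroup.noncommPiCoprod hcomm).rangeRestrict_surjective
  rw [Subgroup.noncommPiCoprod_range] at hnil
  have hle : fittingSubgroup G ≤ ⨆ q, O q := by
    refine sSup_le fun N ⟨hN, hNn⟩ => Subgroup.le_of_forall_normal_isPGroup_le fun q hq X hX hXq => ?_
    by_cases hqG : q ∣ Nat.card G
    · refine le_trans ?_ (le_iSup O ⟨q, Nat.mem_primeFactors.2 ⟨hq.out, hqG, Nat.card_pos.ne'⟩⟩)
      refine Subgroup.normal_le_normalCore.2 ?_
      let P : Sylow q G := default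
      rw [← P.is_maximal' (P.isPGroup'.to_sup_of_normal_right hXq) le_sup_left]
      exact le_sup_right
    · obtain ⟨n, hn⟩ := hXq.exists_card_eq
      have : n = 0 := by
        by_contra h0
        exact hqG ((dvd_pow_self q h0).trans (hn ▸ Subgroup.card_subgroup_dvd_card X))
      rw [this, pow_zero] at hn
      rw [Subgroup.card_eq_one.1 hn]
      exact bot_le
  exact Group.nilpotent_of_mulEquiv (Subgroup.subgroupOfEquivOfLe hle)

theorem map_fittingSubgroup_le {A B : Type*} [Group A] [Group B] (e : A ≃* B) :
    (fittingSubgroup A).map e.toMonoidHom ≤ fittingSubgroup B := by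
  rw [Subgroup.map_le_iff_le_comap]
  refine sSup_le fun N ⟨hN, hNn⟩ => Subgroup.map_le_iff_le_comap.1 ?_
  exact (hN.map e.toMonoidHom e.surjective).le_fittingSubgroup
    (Group.nilpotent_of_mulEquiv (e.subgroupMap N))

theorem map_fittingSubgroup {A B : Type*} [Group A] [Group B] (e : A ≃* B) :
    (fittingSubgroup A).map e.toMonoidHom = fittingSubgroup B := by
  refine le_antisymm (map_fittingSubgroup_le e) fun b hb => ?_
  exact ⟨e.symm b, map_fittingSubgroup_le e.symm ⟨b, hb, rfl⟩, e.apply_symm_apply b⟩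

instance fittingSeries_normal (G : Type*) [Group G] (n : ℕ) : (fittingSeries G n).Normal :=
  (fittingStep^[n] ⟨⊥, inferInstance⟩).2

theorem IsFrobeniusCarter.fittingSubgroup_fixedSubgroup {G H : Type*} [Group G] [Finite G]
    [Group.IsSolvable G] [Group H] [Finite H] {α : H →* MulAut G} {F : Subgroup G}
    (hF : IsFrobeniusCarter α F) :
    fittingSubgroup (fixedSubgroup α) = (fittingSubgroup G).subgroupOf (fixedSubgroup α) := by
  have := fittingSubgroup_normal G
  have := isNilpotent_fittingSubgroup G
  refine le_antisymm (sSup_le fun N ⟨hN, hNn⟩ => ?_) (Subgroup.Normal.le_fittingSubgroup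
    inferInstance ?_)
  · refine Subgroup.le_of_forall_normal_isPGroup_le fun q hq X hX hXq => ?_
    have hp := hF.isPGroup_normalClosure (X := X.map (fixedSubgroup α).subtype)
      (by rintro _ ⟨x, -, rfl⟩; exact x.2)
      (by
        rintro c hc _ ⟨x, hx, rfl⟩
        exact ⟨_, hX.conj_mem x hx ⟨c, hc⟩, rfl⟩) (hXq.map _)
    intro x hx
    exact Subgroup.normalClosure_normal.le_fittingSubgroup hp.isNilpotent
      (Subgroup.subset_normalClosure ⟨x, hx, rfl⟩)
  · let f : (fittingSubgroup G).subgroupOf (fixedSubgroup α) →* fittingSubgroup G :=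
      ((fixedSubgroup α).subtype.comp (Subgroup.subtype _)).codRestrict _ fun x => x.2
    refine Subgroup.isNilpotent_of_ker_le_center f fun x hx => ?_
    have hx1 : (f x : G) = 1 := congrArg Subtype.val (MonoidHom.mem_ker.1 hx)
    have : x = 1 := Subtype.ext (Subtype.ext hx1)
    exact this ▸ Subgroup.one_mem _

/-- Any surjection with kernel Fₙ may replace the canonical quotient map in computing Fₙ₊₁. -/
theorem comap_fittingSubgroup_of_surjective {A B : Type*} [Group A] [Group B] (f : A →* B)
    (hf : Function.Surjective f) {K : Subgroup A} [K.Normal] (hK : f.ker = K) :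
    (fittingSubgroup B).comap f = (fittingSubgroup (A ⧸ K)).comap (QuotientGroup.mk' K) := by
  subst hK
  let e := QuotientGroup.quotientKerEquivOfSurjective f hf
  ext x
  rw [Subgroup.mem_comap, Subgroup.mem_comap, ← map_fittingSubgroup e]
  have hx : e.symm (f x) = QuotientGroup.mk' f.ker x := e.symm_apply_apply (x : A ⧸ f.ker)
  rw [← hx]
  exact Subgroup.mem_map_equiv

theorem fittingSeries_succ (G : Type*) [Group G] (n : ℕ) :
    fittingSeries G (n + 1) = (fittingSubgroup (G ⧸ fittingSeries G n)).comap
      (QuotientGroup.mk' (fittingSeries G n)) := by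
  rw [fittingSeries, Function.iterate_succ_apply']
  rfl

theorem apply_mem_fittingSeries {G : Type*} [Group G] (n : ℕ) (φ : MulAut G) {x : G}
    (hx : x ∈ fittingSeries G n) : φ x ∈ fittingSeries G n := by
  induction n generalizing φ x with
  | zero =>
    have : x = 1 := hx
    rw [this, map_one]
    exact Subgroup.one_mem _
  | succ n ih =>
    let f : G →* G ⧸ fittingSeries G n := (QuotientGroup.mk' _).comp φ.toMonoidHom
    have hf : f.ker = fittingSeries G n := by
      ext y
      rw [MonoidHom.mem_ker]
      refine (QuotientGroup.eq_one_iff (φ y)).trans ⟨fun hy => ?_, ih φ⟩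
      simpa using ih φ⁻¹ hy
    have h := comap_fittingSubgroup_of_surjective f
      ((QuotientGroup.mk'_surjective _).comp (MulEquiv.surjective φ)) hf
    rw [fittingSeries_succ, ← h] at hx
    rw [fittingSeries_succ]
    exact hx

/-- The Fitting series of a finite solvable group reaches the group. -/
theorem exists_fittingSeries_eq_top (G : Type*) [Group G] [Finite G] [Group.IsSolvable G] :
    ∃ n, fittingSeries G n = ⊤ := by
  by_contra! hne
  -- As long as the series has not reached G, each step is strict, since a nontrivial solvable
  -- quotient has a nontrivial abelian normal subgroup; this is impossible at n = |G|.
  have key : ∀ n, n < Nat.card (fittingSeries G n) := by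
    intro n
    induction n with
    | zero => exact Nat.card_pos
    | succ n ih =>
      have htop : (⊤ : Subgroup (G ⧸ fittingSeries G n)) ≠ ⊥ := by
        intro h
        refine hne n (eq_top_iff.2 fun x _ => ?_)
        exact (QuotientGroup.eq_one_iff x).1 (Subgroup.mem_bot.1 (h ▸ Subgroup.mem_top _))
      obtain ⟨p, hp, V, -, hV0, hc, hpow, hchar⟩ := exists_elementaryAbelian_le ⊤ htop
      have hVn : V.Normal := ⟨fun v hv g => hchar (MulAut.conj g) (fun _ _ => Subgroup.mem_top _) v hv⟩
      have := Fact.mk hp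
      have hle := hVn.le_fittingSubgroup (IsPGroup.of_pow_eq_one hpow).isNilpotent
      refine lt_of_le_of_lt (Nat.succ_le_of_lt ih) ?_
      have hsub : fittingSeries G n < fittingSeries G (n + 1) := by
        rw [fittingSeries_succ]
        refine lt_of_le_not_ge (fun x hx => ?_) fun hge => hV0 (eq_bot_iff.2 fun v hv => ?_)
        · rw [Subgroup.mem_comap, QuotientGroup.mk'_apply, (QuotientGroup.eq_one_iff x).2 hx]
          exact Subgroup.one_mem _
        · obtain ⟨x, rfl⟩ := QuotientGroup.mk'_surjective _ v
          exact (QuotientGroup.eq_one_iff x).2 (hge (hle hv))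
      exact Set.Finite.card_lt_card (Set.toFinite _) hsub
  exact absurd (key (Nat.card G)) (not_lt.2 (Subgroup.card_le_card_group _))

theorem fittingSeries_fittingHeight (G : Type*) [Group G] [Finite G] [Group.IsSolvable G] :
    fittingSeries G (fittingHeight G) = ⊤ :=
  Nat.sInf_mem (s := {n | fittingSeries G n = ⊤}) (exists_fittingSeries_eq_top G)

section

variable {G H : Type*} [Group G] [Finite G] [Group.IsSolvable G] [Group H] [Finite H]
  {α : H →* MulAut G} {F : Subgroup G}

/-- Lifting of fixed points makes C_G(H) surject onto the fixed points of G/Fₙ(G), so the statement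
for Fitting subgroups there gives the next term. -/
theorem IsFrobeniusCarter.fittingSeries_fixedSubgroup (hF : IsFrobeniusCarter α F) (n : ℕ) :
    fittingSeries (fixedSubgroup α) n = (fittingSeries G n).subgroupOf (fixedSubgroup α) := by
  induction n with
  | zero =>
    ext x
    exact Subtype.ext_iff
  | succ n ih =>
    let N := fittingSeries G n
    have hN : ∀ h, ∀ x ∈ N, α h x ∈ N := fun h x hx => apply_mem_fittingSeries n (α h) hx
    let f : fixedSubgroup α →* fixedSubgroup (quotientAut α N hN) :=
      ((QuotientGroup.mk' N).comp (fixedSubgroup α).subtype).codRestrict _ fun x h =>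
        congrArg (QuotientGroup.mk' N) (x.2 h)
    have hf : Function.Surjective f := by
      rintro ⟨y, hy⟩
      obtain ⟨g, rfl⟩ := QuotientGroup.mk'_surjective N y
      obtain ⟨m, hm, hgm⟩ := hF.exists_mul_mem_fixed hN (g := g)
        (fun h => QuotientGroup.eq.1 (hy h).symm)
      exact ⟨⟨g * m, hgm⟩, Subtype.ext (QuotientGroup.mk_mul_of_mem g hm)⟩
    have hker : f.ker = fittingSeries (fixedSubgroup α) n := by
      rw [ih]
      ext x
      exact Subtype.ext_iff.trans (QuotientGroup.eq_one_iff (x : G))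
    rw [fittingSeries_succ, ← comap_fittingSubgroup_of_surjective f hf hker,
      (hF.map_mk N hN).fittingSubgroup_fixedSubgroup, fittingSeries_succ]
    rfl

/-- With m the height of C_G(H), all of C_G(H) lies in F_m(G). By lifting, G/F_m(G) has no
nontrivial fixed points, so it equals the image of F. -/
theorem IsFrobeniusCarter.map_fittingSeries_eq_top (hF : IsFrobeniusCarter α F) :
    F.map (QuotientGroup.mk' (fittingSeries G (fittingHeight (fixedSubgroup α)))) = ⊤ := by
  let N := fittingSeries G (fittingHeight (fixedSubgroup α))
  have hN : ∀ h, ∀ x ∈ N, α h x ∈ N := fun h x hx => apply_mem_fittingSeries _ (α h) hx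
  refine (hF.map_mk N hN).eq_top_of_fixedSubgroup_eq_bot (eq_bot_iff.2 fun y hy => ?_)
  obtain ⟨g, rfl⟩ := QuotientGroup.mk'_surjective N y
  obtain ⟨m, hm, hgm⟩ := hF.exists_mul_mem_fixed hN (g := g)
    (fun h => QuotientGroup.eq.1 (hy h).symm)
  have h1 : (⟨g * m, hgm⟩ : fixedSubgroup α) ∈
      fittingSeries (fixedSubgroup α) (fittingHeight (fixedSubgroup α)) := by
    rw [fittingSeries_fittingHeight]
    exact Subgroup.mem_top _
  rw [hF.fittingSeries_fixedSubgroup] at h1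
  exact (QuotientGroup.eq_one_iff g).2 ((N.mul_mem_cancel_right hm).1 h1)

theorem IsFrobeniusCarter.exists_eq_mul_mem_fittingSeries (hF : IsFrobeniusCarter α F) (g : G) :
    ∃ f ∈ F, ∃ x ∈ fittingSeries G (fittingHeight (fixedSubgroup α)), g = f * x := by
  have h : (QuotientGroup.mk' _ g) ∈
      F.map (QuotientGroup.mk' (fittingSeries G (fittingHeight (fixedSubgroup α)))) := by
    rw [hF.map_fittingSeries_eq_top]
    exact Subgroup.mem_top _
  obtain ⟨f, hf, hfg⟩ := h
  exact ⟨f, hf, f⁻¹ * g, QuotientGroup.eq.1 hfg, (mul_inv_cancel_left f g).symm⟩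

theorem IsFrobeniusCarter.fittingHeight_le (hF : IsFrobeniusCarter α F) :
    fittingHeight G ≤ fittingHeight (fixedSubgroup α) + 1 := by
  refine Nat.sInf_le ?_
  have := hF.nilpotent
  have hnil : Group.IsNilpotent
      (⊤ : Subgroup (G ⧸ fittingSeries G (fittingHeight (fixedSubgroup α)))) := by
    rw [← hF.map_fittingSeries_eq_top]
    exact Group.nilpotent_of_surjective (MonoidHom.subgroupMap _ F)
      (MonoidHom.subgroupMap_surjective _ F)
  have htop := Subgroup.Normal.le_fittingSubgroup inferInstance hnil
  rw [Set.mem_ofPred_eq, fittingSeries_succ, top_le_iff.1 htop]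
  rfl

end

/-! ### From the stated hypotheses to the theorem -/

/-- In a finite Frobenius group with kernel `K`, elements outside `K` do not centralize any
nontrivial element of `K`. -/
theorem IsFrobeniusGroupWithKernel.eq_one_of_conj_eq {A : Type*} [Group A] {K : Subgroup A}
    [Finite K] (hK : IsFrobeniusGroupWithKernel K) {a k : A} (ha : a ∉ K) (hk : k ∈ K)
    (hak : a * k * a⁻¹ = k) : k = 1 := by
  obtain ⟨hKn, -, C, -, hcomp, hfpf⟩ := hK
  obtain ⟨⟨⟨k₀, hk₀⟩, ⟨c, hc⟩⟩, hkc⟩ := hcomp.2 a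
  change k₀ * c = a at hkc
  have hc1 : c ≠ 1 := by
    rintro rfl
    rw [mul_one] at hkc
    exact ha (hkc ▸ hk₀)
  -- Writing a = k₀c with 1 ≠ c in the complement, surjectivity of y ↦ y⁻¹·cyc⁻¹ on K shows that a
  -- is conjugate to c under K.
  let θ : K → K := fun y => ⟨(y : A)⁻¹ * (c * y * c⁻¹),
    K.mul_mem (K.inv_mem y.2) (hKn.conj_mem y y.2 c)⟩
  have hθ : Function.Injective θ := by
    intro y z hyz
    have hyz' : (y : A)⁻¹ * (c * y * c⁻¹) = (z : A)⁻¹ * (c * z * c⁻¹) := congrArg Subtype.val hyz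
    have h1 : c * ((z : A) * (y : A)⁻¹) * c⁻¹ = (z : A) * (y : A)⁻¹ := by
      have h2 : c * (z : A) * c⁻¹ = z * (y : A)⁻¹ * (c * y * c⁻¹) := by
        rw [mul_assoc (z : A), hyz', mul_inv_cancel_left]
      calc c * ((z : A) * (y : A)⁻¹) * c⁻¹ = (c * z * c⁻¹) * (c * y * c⁻¹)⁻¹ := by group
        _ = _ := by rw [h2]; group
    have := hfpf c hc hc1 _ (K.mul_mem z.2 (K.inv_mem y.2)) h1
    exact Subtype.ext (mul_inv_eq_one.1 this).symm
  obtain ⟨⟨y, hy⟩, hyk⟩ := Finite.surjective_of_injective hθ ⟨k₀, hk₀⟩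
  have hyk' : y⁻¹ * (c * y * c⁻¹) = k₀ := congrArg Subtype.val hyk
  have hac : a = y⁻¹ * c * y := by
    rw [← hkc, ← hyk']
    group
  have h3 : c * (y * k * y⁻¹) * c⁻¹ = y * k * y⁻¹ := by
    have h4 : y * (a * k * a⁻¹) * y⁻¹ = y * k * y⁻¹ := by rw [hak]
    rw [hac] at h4
    refine Eq.trans ?_ h4
    group
  have h5 := hfpf c hc hc1 _ (hKn.conj_mem k hk y) (by rw [h3])
  rwa [conj_eq_one_iff] at h5

/-- The complement in the Frobenius condition need not be the given copy of H; fixed-point-freeness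
of H holds because nontrivial elements of that copy lie outside the kernel. -/
theorem IsCarterSubgroup.isFrobeniusCarter {G : Type*} [Group G] [Finite G]
    {H : Subgroup (MulAut G)} {F : Subgroup G} (hF : IsCarterSubgroup F)
    (hinv : IsInvariantUnder H F) (hfrob : IsFrobeniusGroupWithKernel
      (SemidirectProduct.inl : F →* F ⋊[restrictedAction H F hinv] H).range) :
    IsFrobeniusCarter H.subtype F := by
  refine ⟨⟨hF.1, fun g hg => ?_⟩, fun h f hf => hinv h h.2 f hf, fun h hh f hf hfix => ?_⟩
  · rw [← hF.2, Subgroup.mem_normalizer_iff]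
    have hle : F.map (MulAut.conj g).toMonoidHom ≤ F := by
      rintro _ ⟨f, hf, rfl⟩
      exact hg f hf
    have heq : F.map (MulAut.conj g).toMonoidHom = F :=
      Subgroup.eq_of_le_of_card_ge hle
        (Subgroup.card_map_of_injective (MulAut.conj g).injective).ge
    refine fun x => ⟨hg x, fun hx => ?_⟩
    rw [← heq] at hx
    obtain ⟨f, hf, hfx⟩ := hx
    rwa [← (MulAut.conj g).injective hfx]
  · have hK : Finite (SemidirectProduct.inl : F →* F ⋊[restrictedAction H F hinv] H).range :=
      Finite.of_surjective _ (MonoidHom.rangeRestrict_surjective _)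
    have hnot : (SemidirectProduct.inr h : F ⋊[restrictedAction H F hinv] H) ∉
        (SemidirectProduct.inl : F →* F ⋊[restrictedAction H F hinv] H).range := by
      rintro ⟨y, hy⟩
      exact hh (congrArg SemidirectProduct.right hy).symm
    have := hfrob.eq_one_of_conj_eq hnot ⟨⟨f, hf⟩, rfl⟩ (by
      rw [← map_inv, ← SemidirectProduct.inl_aut]
      exact congrArg _ (Subtype.ext hfix))
    exact congrArg Subtype.val (SemidirectProduct.inl_injective (this.trans (map_one _).symm))

theorem theorem1p1 {G : Type*} [Group G] [Finite G] [Group.IsSolvable G]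
    (H : Subgroup (MulAut G)) (F : Subgroup G)
    (hcarter : IsCarterSubgroup F) (hinv : IsInvariantUnder H F)
    (hfrob : IsFrobeniusGroupWithKernel
      (SemidirectProduct.inl : F →* F ⋊[restrictedAction H F hinv] H).range) :
    (∀ n : ℕ, (fittingSeries (FixedPoints.subgroup H G) n).map (FixedPoints.subgroup H G).subtype =
        fittingSeries G n ⊓ FixedPoints.subgroup H G) ∧
      fittingHeight G ≤ fittingHeight (FixedPoints.subgroup H G) + 1 ∧
      ∀ g : G, ∃ f ∈ F, ∃ x ∈ fittingSeries G (fittingHeight (FixedPoints.subgroup H G)), g = f * x := by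
  have hF := hcarter.isFrobeniusCarter hinv hfrob
  have hfix : FixedPoints.subgroup H G = fixedSubgroup H.subtype := rfl
  rw [hfix]
  refine ⟨fun n => ?_, hF.fittingHeight_le, hF.exists_eq_mul_mem_fittingSeries⟩
  rw [hF.fittingSeries_fixedSubgroup, Subgroup.subgroupOf_map_subtype]
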